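/- For $j,k\in\mathbb Z$ let $I=[2^{-j}k,2^{-j}(k+1)[$ be a dyadic interval with Haar function $h_I(t)=h_{[0,1[}\big((t-\inf I)/|I|\big)$, where $h_{[0,1[}=\mathbf 1_{[0,1/2[}-\mathbf 1_{[1/2,1[}$, and put $h_{\sigma(I)}(t)=h_I(t-s_j)$ with $s_j=(-1)^j2^{-j}/3$. For a Banach space $X$ and $1<p<\infty$ let $\mathscr U_p(X)\in[0,\infty]$ be the UMD constant, i.e. the least $\beta$ such that $\big\|\sum_{i<n}\varepsilon_i d_i\big\|_{L^p(\Omega,\mu;X)}\le\beta\,\big\|\sum_{i<n}d_i\big\|_{L^p(\Omega,\mu;X)}$ for all probability spaces $(\Omega,\mu)$, all $X$-valued martingale difference sequences $(d_i)$ in $L^p(\Omega,\mu;X)$, all signs $\varepsilon_i\in\{-1,1\}$ and all $n$; $X$ has the UMD property (at the exponent $p$) if $\mathscr U_p(X)<\infty$. **Theorem.** There is a function $C:[0,\infty]\to(0,\infty)$ such that for every $1<p<\infty$ and every Banach space $X$ with the UMD property the following holds, with $C=C(\mathscr U_p(X))$. There is a unique bounded linear operator $S$ on $L^p_X=L^p(\mathbb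 R;X)$ with $S(h_I\,x)=h_{\sigma(I)}\,x$ for all dyadic intervals $I$ and all $x\in X$ (the bilateral alternating one-third-shift operator). It is an isomorphism of $L^p_X$ onto itself, and $$\frac1C\,\|u\|_{L^p_X}\le\|Su\|_{L^p_X}\le C\,\|u\|_{L^p_X}\qquad\text{for all }u\in L^p_X .$$ -/

import Mathlib

open MeasureTheory ProbabilityTheory
open scoped ENNReal

noncomputable section

namespace OneThirdShift

/-- A sequence `d 0, d 1, …` in `L^p(Ω, μ; X)` is a martingale difference sequence with respect to
the filtration `ℱ` if its partial sums `d 0 + ⋯ + d n` form a martingale. -/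
def IsMartingaleDifferenceSeq {X : Type*} [NormedAddCommGroup X] [NormedSpace ℝ X]
    [CompleteSpace X] {Ω : Type*} {mΩ : MeasurableSpace Ω} (p : ℝ≥0∞) (μ : Measure Ω)
    (ℱ : Filtration ℕ mΩ) (d : ℕ → Ω → X) : Prop :=
  (∀ n, MemLp (d n) p μ) ∧
    Martingale (fun n ω => ∑ i ∈ Finset.range (n + 1), d i ω) ℱ μ

/-- `β` is admissible in the `L^p` inequality for the unconditionality of `X`-valued martingale
differences, for all probability spaces, all martingale difference sequences and all signs. -/
def IsUMDBound (X : Type*) [NormedAddCommGroup X] [NormedSpace ℝ X] [CompleteSpace X]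
    (p β : ℝ≥0∞) : Prop :=
  ∀ (Ω : Type) (mΩ : MeasurableSpace Ω) (μ : Measure Ω) (_ : IsProbabilityMeasure μ)
    (ℱ : Filtration ℕ mΩ) (d : ℕ → Ω → X), IsMartingaleDifferenceSeq p μ ℱ d →
    ∀ ε : ℕ → ℝ, (∀ i, ε i = 1 ∨ ε i = -1) → ∀ n : ℕ,
      eLpNorm (fun ω => ∑ i ∈ Finset.range n, ε i • d i ω) p μ
        ≤ β * eLpNorm (fun ω => ∑ i ∈ Finset.range n, d i ω) p μ

/-- The UMD constant `𝒰_p(X)`: the least admissible `β`. It equals `∞` if there is no finite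
admissible constant. -/
def umdConstant (X : Type*) [NormedAddCommGroup X] [NormedSpace ℝ X] [CompleteSpace X]
    (p : ℝ≥0∞) : ℝ≥0∞ :=
  sInf {β : ℝ≥0∞ | IsUMDBound X p β}

/-- The UMD property of `X` at the exponent `p`. -/
def IsUMD (X : Type*) [NormedAddCommGroup X] [NormedSpace ℝ X] [CompleteSpace X]
    (p : ℝ≥0∞) : Prop :=
  umdConstant X p < ∞

/-- The Haar function `h_{[0,1[} = 1_{[0,1/2[} - 1_{[1/2,1[}`. -/
def haarUnit (t : ℝ) : ℝ :=
  (Set.Ico (0 : ℝ) (1 / 2)).indicator 1 t - (Set.Ico (1 / 2 : ℝ) 1).indicator 1 t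

/-- The `L^∞`-normalized Haar function `h_I` of the dyadic interval
`I = [2^{-j} k, 2^{-j} (k + 1)[`, that is `h_I(t) = h_{[0,1[}((t - inf I) / |I|)`. -/
def haar (j k : ℤ) (t : ℝ) : ℝ :=
  haarUnit ((t - (2 : ℝ) ^ (-j) * k) / (2 : ℝ) ^ (-j))

/-- The shift width `s_j = (-1)^j 2^{-j} / 3` of the dyadic intervals of length `2^{-j}`. -/
def shiftWidth (j : ℤ) : ℝ :=
  (-1 : ℝ) ^ j * (2 : ℝ) ^ (-j) / 3

/-- The Haar function `h_{σ(I)}(t) = h_I(t - s(I))` of the shifted interval `σ(I) = I + s(I)`,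
where `I = [2^{-j} k, 2^{-j} (k + 1)[`. -/
def haarShifted (j k : ℤ) (t : ℝ) : ℝ :=
  haar j k (t - shiftWidth j)

theorem memLp_haarUnit_comp {X : Type*} [NormedAddCommGroup X] [NormedSpace ℝ X]
    (p : ℝ≥0∞) (a L : ℝ) (hL : 0 < L) (x : X) :
    MemLp (fun t : ℝ => haarUnit ((t - a) / L) • x) p volume := by
  have key : ∀ b c : ℝ, MemLp (fun t : ℝ =>
      (Set.Ico b c).indicator (1 : ℝ → ℝ) ((t - a) / L) • x) p volume := by
    intro b c
    have h : (fun t : ℝ => (Set.Ico b c).indicator (1 : ℝ → ℝ) ((t - a) / L) • x)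
        = (Set.Ico (b * L + a) (c * L + a)).indicator (fun _ => x) := by
      funext t
      have hiff : (t - a) / L ∈ Set.Ico b c ↔ t ∈ Set.Ico (b * L + a) (c * L + a) := by
        simp only [Set.mem_Ico, le_div_iff₀ hL, div_lt_iff₀ hL]
        constructor <;> rintro ⟨h1, h2⟩ <;> constructor <;> linarith
      by_cases ht : t ∈ Set.Ico (b * L + a) (c * L + a)
      · rw [Set.indicator_of_mem ht, Set.indicator_of_mem (hiff.2 ht)]; simp
      · rw [Set.indicator_of_notMem ht, Set.indicator_of_notMem (fun h => ht (hiff.1 h))]; simp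
    rw [h]
    exact memLp_indicator_const p measurableSet_Ico x (Or.inr (by simp))
  have := (key 0 (1 / 2)).sub (key (1 / 2) 1)
  refine this.congr_norm ?_ (Filter.Eventually.of_forall fun t => ?_)
  · refine this.1.congr (Filter.Eventually.of_forall fun t => ?_)
    simp [haarUnit, sub_smul]
  · simp [haarUnit, sub_smul]

theorem memLp_haar {X : Type*} [NormedAddCommGroup X] [NormedSpace ℝ X]
    (p : ℝ≥0∞) (j k : ℤ) (x : X) : MemLp (fun t => haar j k t • x) p volume :=
  memLp_haarUnit_comp p _ _ (by positivity) x

theorem memLp_haarShifted {X : Type*} [NormedAddCommGroup X] [NormedSpace ℝ X]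
    (p : ℝ≥0∞) (j k : ℤ) (x : X) : MemLp (fun t => haarShifted j k t • x) p volume := by
  have h := memLp_haarUnit_comp p (shiftWidth j + (2 : ℝ) ^ (-j) * k) ((2 : ℝ) ^ (-j))
    (by positivity) x
  simpa only [haarShifted, haar, sub_sub] using h

/-- The operator `T` on `L^p(ℝ; X)` acts as the bilateral alternating one-third-shift on the Haar
system: `T(h_I x) = h_{σ(I)} x` for all dyadic intervals `I` and all `x ∈ X`. -/
def ActsAsOneThirdShift {X : Type*} [NormedAddCommGroup X] [NormedSpace ℝ X]
    {p : ℝ≥0∞} [Fact (1 ≤ p)] (T : Lp X p (volume : Measure ℝ) →L[ℝ] Lp X p (volume : Measure ℝ)) :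
    Prop :=
  ∀ (j k : ℤ) (x : X), T ((memLp_haar p j k x).toLp _) = (memLp_haarShifted p j k x).toLp _

end OneThirdShift

end

/-! Fix finitely many coefficients and compare their Haar sums over two nested dyadic lattices whose
offsets at each level differ by at most half an interval; here these are the standard lattice and
the one shifted by `shiftWidth`. Within one lattice, the level-`j` part of a Haar sum is `halfSign •
levelCoeff`. It is odd under exchanging the halves of the level-`j` intervals, and that exchange
leaves coarser levels unchanged. So the levels form a martingale difference sequence, and UMD makes
the norm comparable with that of the sum with random signs. The distribution of random signs absorbs
the half signs, which leaves `randomNorm`, where only the values on whole intervals matter.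

The random norms of the two lattices are compared in `IsUMDBound.randomNorm_le_randomNorm`. One half
of each interval of the second lattice lies in the interval of the first with the same index, so
there the two level functions agree. The other halves are controlled by
`IsUMDBound.eLpNorm_sub_halves_le`, a further martingale transform. Together with two passages
between Haar sums and random sums this gives the constant `β (1 + β) β`, and the argument is
symmetric in the two lattices.

Since `p > 1`, Haar sums over either lattice are dense (`IsNested.denseRange_haarMap`), so the
correspondence of Haar sums extends uniquely to an isomorphism. -/

namespace OneThirdShift

/-! ### Martingale differences from measure preserving symmetries -/

section Unconditionality

variable {Ω : Type*} {mΩ : MeasurableSpace Ω}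

/-- The filtration whose `n`-th term consists of the measurable sets that are invariant under
all the maps `τ l` with `n < l`. -/
def invariantFiltration (mΩ : MeasurableSpace Ω) (τ : ℕ → Ω → Ω) : Filtration ℕ mΩ where
  seq n :=
    { MeasurableSet' := fun s => MeasurableSet s ∧ ∀ l, n < l → τ l ⁻¹' s = s
      measurableSet_empty := by simp
      measurableSet_compl := fun s hs => ⟨hs.1.compl, fun l hl => by
        rw [Set.preimage_compl, hs.2 l hl]⟩
      measurableSet_iUnion := fun s hs => ⟨MeasurableSet.iUnion fun i => (hs i).1, fun l hl => by
        rw [Set.preimage_iUnion, Set.iUnion_congr fun i => (hs i).2 l hl]⟩ }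
  mono' := fun _ _ hmn _ hs => ⟨hs.1, fun l hl => hs.2 l (hmn.trans_lt hl)⟩
  le' := fun _ _ hs => hs.1

theorem stronglyMeasurable_invariantFiltration {X : Type*} [NormedAddCommGroup X]
    {τ : ℕ → Ω → Ω} {f : Ω → X} (hf : StronglyMeasurable f) {n : ℕ}
    (h : ∀ l, n < l → ∀ ω, f (τ l ω) = f ω) :
    StronglyMeasurable[invariantFiltration mΩ τ n] f := by
  borelize X
  obtain ⟨hm, hs⟩ := stronglyMeasurable_iff_measurable_separable.1 hf
  refine stronglyMeasurable_iff_measurable_separable.2 ⟨fun s hs => ⟨hm hs, fun l hl => ?_⟩, hs⟩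
  ext ω
  simp [h l hl ω]

variable {X : Type*} [NormedAddCommGroup X] [NormedSpace ℝ X] [CompleteSpace X]

/-- Functions `d i` that are odd under a measure preserving map `τ i` leaving all earlier `d l`
invariant form a martingale difference sequence. -/
theorem isMartingaleDifferenceSeq_of_odd {p : ℝ≥0∞} (hp : 1 ≤ p) {μ : Measure Ω}
    [IsFiniteMeasure μ] {d : ℕ → Ω → X} {τ : ℕ → Ω → Ω} (hd : ∀ i, StronglyMeasurable (d i))
    (hLp : ∀ i, MemLp (d i) p μ) (hτ : ∀ i, MeasurePreserving (τ i) μ μ)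
    (hodd : ∀ i ω, d i (τ i ω) = -d i ω) (hinv : ∀ l i, l < i → ∀ ω, d l (τ i ω) = d l ω) :
    IsMartingaleDifferenceSeq p μ (invariantFiltration mΩ τ) d := by
  have hint : ∀ i, Integrable (d i) μ := fun i => (hLp i).integrable hp
  refine ⟨hLp, martingale_of_setIntegral_eq_succ (fun n => ?_) (fun n => ?_) fun n s hs => ?_⟩
  · refine Finset.stronglyMeasurable_fun_sum (m := invariantFiltration mΩ τ n) _ fun i hi => ?_
    exact stronglyMeasurable_invariantFiltration (hd i) fun l hl =>
      hinv i l (by have := Finset.mem_range.1 hi; omega)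
  · exact integrable_finsetSum _ fun i _ => hint i
  · have hzero : ∫ ω in s, d (n + 1) ω ∂μ = 0 := by
      have hmp := (hτ (n + 1)).restrict_preimage hs.1
      rw [hs.2 _ n.lt_succ_self] at hmp
      have h := integral_map (μ := μ.restrict s) (f := d (n + 1)) hmp.measurable.aemeasurable
        (hd (n + 1)).aestronglyMeasurable
      rw [hmp.map_eq] at h
      simp only [hodd, integral_neg] at h
      have : IsAddTorsionFree X := .of_isTorsionFree ℝ X
      exact self_eq_neg.1 h
    simp only [Finset.sum_range_succ _ (n + 1)]
    rw [integral_add (integrable_finsetSum _ fun i _ => (hint i).integrableOn)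
      (hint _).integrableOn, hzero, add_zero]

end Unconditionality

/-- Carries UMD from probability spaces to functions living on a set of finite measure: after
normalizing `μ` on `E`, both norms acquire the same finite nonzero factor, which cancels. -/
theorem IsUMDBound.eLpNorm_sum_le_of_odd {X : Type*} [NormedAddCommGroup X] [NormedSpace ℝ X]
    [CompleteSpace X] {p β : ℝ≥0∞} (hβ : IsUMDBound X p β) (hp : 1 ≤ p) (hp' : p ≠ ∞)
    {Ω : Type} {mΩ : MeasurableSpace Ω} {μ : Measure Ω} {E : Set Ω} (hE : MeasurableSet E)
    (hμE : μ E ≠ ∞) {n : ℕ} {d : ℕ → Ω → X} {τ : ℕ → Ω → Ω}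
    (hd : ∀ i < n, StronglyMeasurable (d i)) (hLp : ∀ i < n, MemLp (d i) p μ)
    (hsupp : ∀ i < n, Function.support (d i) ⊆ E)
    (hτ : ∀ i < n, MeasurePreserving (τ i) μ μ) (hτE : ∀ i < n, τ i ⁻¹' E = E)
    (hodd : ∀ i < n, ∀ ω, d i (τ i ω) = -d i ω)
    (hinv : ∀ i < n, ∀ l < i, ∀ ω, d l (τ i ω) = d l ω)
    {ε : ℕ → ℝ} (hε : ∀ i, ε i = 1 ∨ ε i = -1) :
    eLpNorm (fun ω => ∑ i ∈ Finset.range n, ε i • d i ω) p μ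
      ≤ β * eLpNorm (fun ω => ∑ i ∈ Finset.range n, d i ω) p μ := by
  have hsum : ∀ e : ℕ → ℝ,
      Function.support (fun ω => ∑ i ∈ Finset.range n, e i • d i ω) ⊆ E := by
    intro e ω hω
    by_contra h
    refine hω (Finset.sum_eq_zero fun i hi => ?_)
    rw [Function.notMem_support.1 fun h' => h (hsupp i (Finset.mem_range.1 hi) h'), smul_zero]
  have hsum' : Function.support (fun ω => ∑ i ∈ Finset.range n, d i ω) ⊆ E := by
    simpa using hsum 1
  rw [← eLpNorm_restrict_eq_of_support_subset (hsum ε),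
    ← eLpNorm_restrict_eq_of_support_subset hsum']
  rcases eq_or_ne (μ E) 0 with h0 | h0
  · simp [Measure.restrict_eq_zero.2 h0]
  have hc : (μ E)⁻¹ ≠ ∞ := ENNReal.inv_ne_top.2 h0
  have hprob : IsProbabilityMeasure ((μ E)⁻¹ • μ.restrict E) :=
    ⟨by simp [ENNReal.inv_mul_cancel h0 hμE]⟩
  -- The finite sequence is continued by zero differences, with the identity as symmetry.
  have key := hβ Ω mΩ ((μ E)⁻¹ • μ.restrict E) hprob _ (fun i => if i < n then d i else 0)
    (isMartingaleDifferenceSeq_of_odd (τ := fun i => if i < n then τ i else id) hp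
      (fun i => ?_) (fun i => ?_) (fun i => ?_) (fun i ω => ?_) (fun l i hl ω => ?_)) ε hε n
  · have hcongr : ∀ e : ℕ → ℝ,
        (fun ω => ∑ i ∈ Finset.range n, e i • (if i < n then d i else 0) ω)
          = fun ω => ∑ i ∈ Finset.range n, e i • d i ω := fun e => by
      funext ω
      exact Finset.sum_congr rfl fun i hi => by rw [if_pos (Finset.mem_range.1 hi)]
    have h1 := hcongr 1
    simp only [Pi.one_apply, one_smul] at h1
    rw [hcongr, h1, eLpNorm_smul_measure_of_ne_top hp', eLpNorm_smul_measure_of_ne_top hp',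
      smul_eq_mul, smul_eq_mul, mul_left_comm] at key
    refine (ENNReal.mul_le_mul_iff_right ?_ ?_).1 key
    · exact (ENNReal.rpow_pos (ENNReal.inv_pos.2 hμE) hc).ne'
    · exact ENNReal.rpow_ne_top_of_nonneg ENNReal.toReal_nonneg hc
  · split_ifs with hi
    exacts [hd i hi, stronglyMeasurable_zero]
  · split_ifs with hi
    exacts [((hLp i hi).restrict E).smul_measure hc, MemLp.zero]
  · split_ifs with hi
    · have := (hτ i hi).restrict_preimage hE
      rw [hτE i hi] at this
      exact this.smul_measure _
    · exact MeasurePreserving.id _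
  · split_ifs with hi
    exacts [hodd i hi ω, by simp]
  · by_cases hi : i < n
    · simp only [if_pos hi, if_pos (hl.trans hi)]
      exact hinv i hi l hl ω
    · simp [if_neg hi]

/-! ### Nested dyadic lattices: indices, half signs and half swaps -/

section Lattice

/-- The index `k` of the interval `a j + [2^{-j} k, 2^{-j} (k + 1)[` that contains `t`. -/
noncomputable def cell (a : ℤ → ℝ) (j : ℤ) (t : ℝ) : ℤ := ⌊(t - a j) * (2 : ℝ) ^ j⌋

/-- `1` on the left halves of the intervals `a j + [2^{-j} k, 2^{-j} (k + 1)[` and `-1` on the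
right halves. -/
noncomputable def halfSign (a : ℤ → ℝ) (j : ℤ) (t : ℝ) : ℝ :=
  if Int.fract ((t - a j) * (2 : ℝ) ^ j) < 1 / 2 then 1 else -1

/-- The map exchanging the halves of each interval `a j + [2^{-j} k, 2^{-j} (k + 1)[`. -/
noncomputable def halfSwap (a : ℤ → ℝ) (j : ℤ) (t : ℝ) : ℝ :=
  t + halfSign a j t * ((2 : ℝ) ^ (-j) / 2)

/-- Each interval of level `j` is a union of intervals of level `j + 1`. -/
def IsNested (a : ℤ → ℝ) : Prop :=
  ∀ j : ℤ, ∃ m : ℤ, (a j - a (j + 1)) * (2 : ℝ) ^ (j + 1) = m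

variable {a b : ℤ → ℝ}

theorem halfSign_eq_or (a : ℤ → ℝ) (j : ℤ) (t : ℝ) : halfSign a j t = 1 ∨ halfSign a j t = -1 := by
  unfold halfSign; split_ifs <;> simp

theorem halfSign_eq_one_iff (j : ℤ) (t : ℝ) :
    halfSign a j t = 1 ↔ Int.fract ((t - a j) * (2 : ℝ) ^ j) < 1 / 2 := by
  unfold halfSign; split_ifs with h
  · simpa using h
  · norm_num; linarith

theorem halfSign_eq_neg_one_iff (j : ℤ) (t : ℝ) :
    halfSign a j t = -1 ↔ 1 / 2 ≤ Int.fract ((t - a j) * (2 : ℝ) ^ j) := by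
  unfold halfSign; split_ifs with h
  · norm_num; linarith
  · simpa using h

theorem coord_add (j : ℤ) (t s : ℝ) :
    (t + s * ((2 : ℝ) ^ (-j) / 2) - a j) * (2 : ℝ) ^ j = (t - a j) * (2 : ℝ) ^ j + s / 2 := by
  have : (2 : ℝ) ^ (-j) * (2 : ℝ) ^ j = 1 := by rw [← zpow_add₀ two_ne_zero]; simp
  linear_combination s / 2 * this

theorem cell_eq_iff (j : ℤ) (t : ℝ) (k : ℤ) :
    cell a j t = k ↔ (k : ℝ) ≤ (t - a j) * (2 : ℝ) ^ j ∧ (t - a j) * (2 : ℝ) ^ j < k + 1 :=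
  Int.floor_eq_iff

theorem halfSign_eq_one_iff_cell (j : ℤ) (t : ℝ) :
    halfSign a j t = 1 ↔ (t - a j) * (2 : ℝ) ^ j < cell a j t + 1 / 2 := by
  rw [halfSign_eq_one_iff, Int.fract, sub_lt_iff_lt_add', cell]

theorem halfSign_eq_neg_one_iff_cell (j : ℤ) (t : ℝ) :
    halfSign a j t = -1 ↔ (cell a j t : ℝ) + 1 / 2 ≤ (t - a j) * (2 : ℝ) ^ j := by
  rw [halfSign_eq_neg_one_iff, Int.fract, le_sub_iff_add_le', cell]

theorem cell_halfSwap (j : ℤ) (t : ℝ) : cell a j (halfSwap a j t) = cell a j t := by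
  have h := (cell_eq_iff (a := a) j t _).1 rfl
  rw [cell_eq_iff, halfSwap, coord_add]
  rcases halfSign_eq_or a j t with h1 | h1
  · rw [h1]; rw [halfSign_eq_one_iff_cell] at h1
    constructor <;> linarith
  · rw [h1]; rw [halfSign_eq_neg_one_iff_cell] at h1
    constructor <;> linarith

theorem halfSign_halfSwap (j : ℤ) (t : ℝ) : halfSign a j (halfSwap a j t) = -halfSign a j t := by
  have h := (cell_eq_iff (a := a) j t _).1 rfl
  rcases halfSign_eq_or a j t with h1 | h1
  · rw [h1, halfSign_eq_neg_one_iff_cell, cell_halfSwap, halfSwap, coord_add, h1]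
    linarith
  · rw [h1, neg_neg, halfSign_eq_one_iff_cell, cell_halfSwap, halfSwap, coord_add, h1]
    linarith

/-- Up to an offset depending only on the level, passing to the parent is halving the index, and the
parity tells which half of the parent one is in. Hence coarser data are functions of the finer
index. -/
theorem IsNested.exists_succ (ha : IsNested a) (j : ℤ) : ∃ m : ℤ, ∀ t,
    cell a j t = (cell a (j + 1) t + m) / 2 ∧
      halfSign a j t = if (cell a (j + 1) t + m) % 2 = 0 then 1 else -1 := by
  obtain ⟨m, hm⟩ := ha j
  refine ⟨-m, fun t => ?_⟩
  have h := (cell_eq_iff (a := a) (j + 1) t _).1 rfl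
  set k := cell a (j + 1) t
  have hy : (t - a (j + 1)) * (2 : ℝ) ^ (j + 1) = 2 * ((t - a j) * (2 : ℝ) ^ j) + m := by
    rw [← hm, zpow_add_one₀ two_ne_zero]; ring
  rw [hy] at h
  have hdiv : ((k + -m : ℤ) : ℝ) = 2 * ((k + -m) / 2 : ℤ) + ((k + -m) % 2 : ℤ) := by
    exact_mod_cast (Int.mul_ediv_add_emod (k + -m) 2).symm
  push_cast at hdiv
  have hcell : cell a j t = (k + -m) / 2 := by
    rw [cell_eq_iff]
    rcases Int.emod_two_eq_zero_or_one (k + -m) with h0 | h0 <;> rw [h0] at hdiv <;>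
      push_cast at hdiv ⊢ <;> constructor <;> linarith
  refine ⟨hcell, ?_⟩
  rcases Int.emod_two_eq_zero_or_one (k + -m) with h0 | h0
  · rw [if_pos h0, halfSign_eq_one_iff_cell, hcell]
    rw [h0] at hdiv; push_cast at hdiv ⊢; linarith
  · rw [if_neg (by omega), halfSign_eq_neg_one_iff_cell, hcell]
    rw [h0] at hdiv; push_cast at hdiv ⊢; linarith

theorem IsNested.exists_ancestor (ha : IsNested a) {l j : ℤ} (hlj : l ≤ j) :
    ∃ f : ℤ → ℤ, ∀ t, cell a l t = f (cell a j t) := by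
  induction j, hlj using Int.leInduction with
  | base => exact ⟨id, fun t => rfl⟩
  | succ j _ ih =>
    obtain ⟨f, hf⟩ := ih
    obtain ⟨m, hm⟩ := ha.exists_succ j
    exact ⟨fun k => f ((k + m) / 2), fun t => by rw [hf, (hm t).1]⟩

theorem IsNested.cell_halfSwap_of_le (ha : IsNested a) {l j : ℤ} (hlj : l ≤ j) (t : ℝ) :
    cell a l (halfSwap a j t) = cell a l t := by
  obtain ⟨f, hf⟩ := ha.exists_ancestor hlj
  rw [hf, hf, cell_halfSwap]

theorem IsNested.halfSign_halfSwap_of_lt (ha : IsNested a) {l j : ℤ} (hlj : l < j) (t : ℝ) :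
    halfSign a l (halfSwap a j t) = halfSign a l t := by
  obtain ⟨m, hm⟩ := ha.exists_succ l
  rw [(hm _).2, (hm _).2, ha.cell_halfSwap_of_le hlj]

theorem measurable_cell (a : ℤ → ℝ) (j : ℤ) : Measurable (cell a j) :=
  Int.measurable_floor.comp (by fun_prop)

theorem measurable_halfSign (a : ℤ → ℝ) (j : ℤ) : Measurable (halfSign a j) :=
  Measurable.ite (measurableSet_lt (measurable_fract.comp (by fun_prop)) measurable_const)
    measurable_const measurable_const

theorem measurable_halfSwap (a : ℤ → ℝ) (j : ℤ) : Measurable (halfSwap a j) :=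
  measurable_id.add ((measurable_halfSign a j).mul_const _)

theorem halfSign_add_halfWidth (j : ℤ) (t : ℝ) :
    halfSign a j (t + (2 : ℝ) ^ (-j) / 2) = -halfSign a j t := by
  rcases halfSign_eq_or a j t with h | h
  · rw [← halfSign_halfSwap, halfSwap, h, one_mul]
  -- On a right half, the swap moves left by half a width. The point `t + 2^{-j} / 2` is one full
  -- period to the right of the swapped point, so it has the same half sign.
  · have h2 := halfSign_halfSwap (a := a) j t
    have h0 := coord_add (a := a) j (t + -1 * ((2 : ℝ) ^ (-j) / 2)) 2
    have h1 : halfSign a j (t + -1 * ((2 : ℝ) ^ (-j) / 2) + 2 * ((2 : ℝ) ^ (-j) / 2)) =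
        halfSign a j (t + -1 * ((2 : ℝ) ^ (-j) / 2)) := by
      unfold halfSign
      rw [h0, div_self two_ne_zero, Int.fract_add_one]
    rw [halfSwap, h] at h2
    rw [h, ← h2, ← h1]
    congr 1; ring

theorem measurePreserving_halfSwap (a : ℤ → ℝ) (j : ℤ) :
    MeasurePreserving (halfSwap a j) volume volume := by
  refine ⟨measurable_halfSwap a j, Measure.ext fun s hs => ?_⟩
  rw [Measure.map_apply (measurable_halfSwap a j) hs]
  set δ : ℝ := (2 : ℝ) ^ (-j) / 2
  set L : Set ℝ := {t | halfSign a j t = 1}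
  have hL : MeasurableSet L := measurable_halfSign a j (measurableSet_singleton 1)
  have hmem : ∀ t, t + δ ∈ L ↔ t ∉ L := fun t => by
    simp only [L, Set.mem_ofPred_eq, δ, halfSign_add_halfWidth]
    rcases halfSign_eq_or a j t with h | h <;> rw [h] <;> norm_num
  -- The swap is translation by `δ` on the left halves `L` and by `-δ` off them; translation by `δ`
  -- exchanges `L` with its complement.
  have h1 : halfSwap a j ⁻¹' s ∩ L = (· + δ) ⁻¹' (s \ L) := by
    ext t
    simp only [Set.mem_inter_iff, Set.mem_preimage, Set.mem_sdiff, hmem, not_not]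
    refine and_congr_left fun (h : halfSign a j t = 1) => ?_
    rw [halfSwap, h, one_mul]
  have h2 : halfSwap a j ⁻¹' s \ L = (· + -δ) ⁻¹' (s ∩ L) := by
    ext t
    have := hmem (t + -δ)
    rw [neg_add_cancel_right] at this
    simp only [Set.mem_inter_iff, Set.mem_preimage, Set.mem_sdiff, this, not_not]
    refine and_congr_left fun h => ?_
    have h' : halfSign a j t = -1 := (halfSign_eq_or a j t).resolve_left fun h0 => this.1 h0 h
    rw [halfSwap, h', neg_one_mul]
  rw [← measure_inter_add_sdiff _ hL, h1, h2, measure_preimage_add_right,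
    measure_preimage_add_right, add_comm, measure_inter_add_sdiff _ hL]

theorem haar_sub_eq (a : ℤ → ℝ) (j k : ℤ) (t : ℝ) :
    haar j k (t - a j) = if cell a j t = k then halfSign a j t else 0 := by
  have h2 : (t - a j - (2 : ℝ) ^ (-j) * k) / (2 : ℝ) ^ (-j) = (t - a j) * (2 : ℝ) ^ j - k := by
    rw [zpow_neg, div_inv_eq_mul, sub_mul, mul_right_comm,
      inv_mul_cancel₀ (zpow_ne_zero _ two_ne_zero), one_mul]
  rw [haar, h2, haarUnit]
  set y := (t - a j) * (2 : ℝ) ^ j with hy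
  split_ifs with h
  · rcases halfSign_eq_or a j t with h1 | h1
    · have h3 := (halfSign_eq_one_iff_cell (a := a) j t).1 h1
      rw [cell_eq_iff, ← hy] at h
      rw [(cell_eq_iff j t k).2 h, ← hy] at h3
      rw [h1, Set.indicator_of_mem, Set.indicator_of_notMem]
      · simp
      · simp only [Set.mem_Ico, not_and_or]; left; linarith
      · constructor <;> linarith
    · have h3 := (halfSign_eq_neg_one_iff_cell (a := a) j t).1 h1
      rw [cell_eq_iff, ← hy] at h
      rw [(cell_eq_iff j t k).2 h, ← hy] at h3
      rw [h1, Set.indicator_of_notMem, Set.indicator_of_mem]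
      · simp
      · constructor <;> linarith
      · simp only [Set.mem_Ico, not_and_or]; right; linarith
  · rw [cell_eq_iff, ← hy] at h
    rw [Set.indicator_of_notMem, Set.indicator_of_notMem, sub_zero]
    · rintro ⟨h3, h4⟩; exact h ⟨by linarith, by linarith⟩
    · rintro ⟨h3, h4⟩; exact h ⟨by linarith, by linarith⟩

/-- The sign of the halves of the intervals of the lattice `b` of level `j` that lie in the
interval of the lattice `a` with the same index. -/
noncomputable def sideSign (a b : ℤ → ℝ) (j : ℤ) : ℝ := if a j ≤ b j then 1 else -1

theorem sideSign_eq_or (a b : ℤ → ℝ) (j : ℤ) : sideSign a b j = 1 ∨ sideSign a b j = -1 := by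
  unfold sideSign; split_ifs <;> simp

/-- An interval moved right by at most half its length keeps its left half inside the original, and
one moved left keeps its right half. `sideSign` selects that half. -/
theorem cell_eq_of_sideSign_mul {j : ℤ} (hab : |a j - b j| ≤ (2 : ℝ) ^ (-j) / 2) {t : ℝ}
    (ht : sideSign a b j * halfSign b j t = 1) : cell a j t = cell b j t := by
  have h := (cell_eq_iff (a := b) j t _).1 rfl
  have hpos : (0 : ℝ) < 2 ^ j := by positivity
  have hab' : |(b j - a j) * (2 : ℝ) ^ j| ≤ 1 / 2 := by
    rw [abs_mul, abs_sub_comm, abs_of_pos hpos]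
    calc _ ≤ (2 : ℝ) ^ (-j) / 2 * 2 ^ j := by gcongr
      _ = 1 / 2 := by rw [zpow_neg]; field_simp
  rw [abs_le] at hab'
  have hy : (t - a j) * (2 : ℝ) ^ j = (t - b j) * (2 : ℝ) ^ j + (b j - a j) * (2 : ℝ) ^ j := by ring
  rw [cell_eq_iff, hy]
  unfold sideSign at ht
  split_ifs at ht with hle
  · rw [one_mul, halfSign_eq_one_iff_cell] at ht
    have : 0 ≤ (b j - a j) * (2 : ℝ) ^ j := mul_nonneg (by linarith) hpos.le
    constructor <;> linarith
  · have ht' : halfSign b j t = -1 := by linarith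
    rw [halfSign_eq_neg_one_iff_cell] at ht'
    have : (b j - a j) * (2 : ℝ) ^ j ≤ 0 :=
      mul_nonpos_of_nonpos_of_nonneg (by linarith) hpos.le
    constructor <;> linarith

end Lattice

/-! ### Rademacher sums and invariance under sign changes -/

section RandomSigns

variable {n : ℕ}

/-- The `i`-th Rademacher function on the space `Fin n → Bool` of signs. -/
noncomputable def rademacher (w : Fin n → Bool) (i : ℕ) : ℝ :=
  if h : i < n then (if w ⟨i, h⟩ then -1 else 1) else 1

/-- Coordinatewise multiplication of a sequence of signs by `s`. -/
noncomputable def mulSigns (s : ℕ → ℝ) (w : Fin n → Bool) : Fin n → Bool :=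
  fun i => if s i = 1 then w i else !w i

/-- The uniform probability measure on `Fin n → Bool`. -/
noncomputable def signMeasure (n : ℕ) : Measure (Fin n → Bool) := uniformOn Set.univ

instance : IsProbabilityMeasure (signMeasure n) :=
  isProbabilityMeasure_uniformOn Set.finite_univ Set.univ_nonempty

theorem rademacher_eq_or (w : Fin n → Bool) (i : ℕ) :
    rademacher w i = 1 ∨ rademacher w i = -1 := by
  unfold rademacher; split_ifs <;> simp

theorem rademacher_mulSigns {s : ℕ → ℝ} (hs : ∀ i, s i = 1 ∨ s i = -1) (w : Fin n → Bool) {i : ℕ}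
    (hi : i < n) : rademacher (mulSigns s w) i = rademacher w i * s i := by
  unfold rademacher mulSigns
  simp only [hi, dite_true]
  rcases hs i with h | h
  · simp [h]
  · have : (-1 : ℝ) ≠ 1 := by norm_num
    rw [h]
    cases hw : w ⟨i, hi⟩ <;> simp [this]

theorem measurable_rademacher (i : ℕ) : Measurable fun w : Fin n → Bool => rademacher w i :=
  measurable_of_countable _

theorem map_signMeasure_mulSigns (s : ℕ → ℝ) :
    (signMeasure n).map (mulSigns s) = signMeasure n := by
  -- An involution permutes the finite sign space, so it preserves counting.
  have hinv : Function.Involutive (mulSigns s : (Fin n → Bool) → Fin n → Bool) := by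
    intro w
    funext i
    unfold mulSigns
    split_ifs <;> simp
  ext A hA
  rw [Measure.map_apply (measurable_of_countable _) hA, signMeasure, uniformOn_univ,
    uniformOn_univ, Measure.count_apply (measurable_of_countable _ hA),
    Measure.count_apply hA]
  congr 2
  rw [← Set.image_eq_preimage_of_inverse hinv.leftInverse hinv.rightInverse,
    hinv.injective.encard_image]

theorem measurable_mulSigns {α : Type*} [MeasurableSpace α] {s : ℕ → α → ℝ}
    (hs : ∀ i, Measurable (s i)) :
    Measurable fun q : α × (Fin n → Bool) => mulSigns (fun i => s i q.1) q.2 := by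
  refine measurable_pi_iff.2 fun i => Measurable.ite ?_ ?_ ?_
  · exact ((hs i).comp measurable_fst) (measurableSet_singleton 1)
  · fun_prop
  · exact (measurable_of_countable not).comp (by fun_prop)

variable {X : Type*} [NormedAddCommGroup X]

/-- Raise to the power `p` and integrate the fibrewise estimates over `w` by Tonelli. -/
theorem eLpNorm_prod_le_of_forall {α W : Type*} [MeasurableSpace α] [MeasurableSpace W]
    {μ : Measure α} {ν : Measure W} [SFinite μ] [SFinite ν] {p β : ℝ≥0∞} (hp : p ≠ 0)
    (hp' : p ≠ ∞) (hβ : β ≠ ∞) {f g : α × W → X} (hf : StronglyMeasurable f)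
    (hg : StronglyMeasurable g)
    (h : ∀ w, eLpNorm (fun t => f (t, w)) p μ ≤ β * eLpNorm (fun t => g (t, w)) p μ) :
    eLpNorm f p (μ.prod ν) ≤ β * eLpNorm g p (μ.prod ν) := by
  have hpos := ENNReal.toReal_pos hp hp'
  simp only [eLpNorm_eq_lintegral_rpow_enorm_toReal hp hp'] at h ⊢
  rw [← ENNReal.rpow_le_rpow_iff hpos, ENNReal.mul_rpow_of_nonneg _ _ hpos.le, ← ENNReal.rpow_mul,
    ← ENNReal.rpow_mul, one_div, inv_mul_cancel₀ hpos.ne', ENNReal.rpow_one, ENNReal.rpow_one,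
    lintegral_prod_symm' _ (hf.enorm.pow_const _), lintegral_prod_symm' _ (hg.enorm.pow_const _),
    ← lintegral_const_mul' _ _ (ENNReal.rpow_ne_top_of_nonneg hpos.le hβ)]
  refine lintegral_mono fun w => ?_
  have := ENNReal.rpow_le_rpow (h w) hpos.le
  rwa [ENNReal.mul_rpow_of_nonneg _ _ hpos.le, ← ENNReal.rpow_mul, ← ENNReal.rpow_mul, one_div,
    inv_mul_cancel₀ hpos.ne', ENNReal.rpow_one, ENNReal.rpow_one] at this

variable [NormedSpace ℝ X]

theorem stronglyMeasurable_rademacher_sum {g : ℕ → ℝ → X} (hg : ∀ i, StronglyMeasurable (g i)) :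
    StronglyMeasurable fun q : ℝ × (Fin n → Bool) =>
      ∑ i ∈ Finset.range n, rademacher q.2 i • g i q.1 :=
  Finset.stronglyMeasurable_fun_sum _ fun i _ =>
    (((measurable_rademacher i).comp measurable_snd).stronglyMeasurable).smul
      ((hg i).comp_measurable measurable_fst)

/-- The distribution of a Rademacher sum is invariant under changes of signs. -/
theorem eLpNorm_rademacher_sum_smul (p : ℝ≥0∞) {g : ℕ → ℝ → X}
    (hg : ∀ i, StronglyMeasurable (g i)) {s : ℕ → ℝ → ℝ} (hs : ∀ i t, s i t = 1 ∨ s i t = -1)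
    (hsm : ∀ i, Measurable (s i)) :
    eLpNorm (fun q : ℝ × (Fin n → Bool) =>
        ∑ i ∈ Finset.range n, rademacher q.2 i • s i q.1 • g i q.1) p
        (volume.prod (signMeasure n))
      = eLpNorm (fun q : ℝ × (Fin n → Bool) =>
        ∑ i ∈ Finset.range n, rademacher q.2 i • g i q.1) p (volume.prod (signMeasure n)) := by
  -- The signs may depend on `t`: for each fixed `t` they preserve the uniform measure on the second
  -- factor, so the skew product preserves the product measure.
  have hmp := MeasurePreserving.skew_product (μc := signMeasure n) (μd := signMeasure n)
    (MeasurePreserving.id (volume : Measure ℝ)) (g := fun t => mulSigns (fun i => s i t))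
    (measurable_mulSigns hsm) (Filter.Eventually.of_forall fun t => map_signMeasure_mulSigns _)
  rw [← eLpNorm_comp_measurePreserving
    (stronglyMeasurable_rademacher_sum hg).aestronglyMeasurable hmp]
  congr 1
  funext q
  refine Finset.sum_congr rfl fun i hi => ?_
  simp only [id, smul_smul, rademacher_mulSigns (fun i => hs i q.1) q.2 (Finset.mem_range.1 hi)]

end RandomSigns

/-! ### Level functions and a common support of finite measure -/

section Support

variable {X : Type*} [NormedAddCommGroup X] {a : ℤ → ℝ}

theorem volume_cell_preimage_lt_top (a : ℤ → ℝ) (j : ℤ) (S : Finset ℤ) :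
    volume (cell a j ⁻¹' S) < ∞ := by
  have : cell a j ⁻¹' S = ⋃ k ∈ S, cell a j ⁻¹' {k} := by ext; simp
  rw [this]
  refine measure_biUnion_lt_top S.finite_toSet fun k _ => ?_
  refine (measure_mono (t := Set.Icc (k / (2 : ℝ) ^ j + a j) ((k + 1) / (2 : ℝ) ^ j + a j))
    fun t ht => ?_).trans_lt (by simp)
  obtain ⟨h1, h2⟩ := (cell_eq_iff j t k).1 ht
  have hpos : (0 : ℝ) < 2 ^ j := by positivity
  exact ⟨by linarith [(div_le_iff₀ hpos).2 h1], by linarith [(lt_div_iff₀ hpos).2 h2]⟩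

/-- The function that takes the value `c (j, k)` on the interval `a j + [2^{-j} k, 2^{-j} (k + 1)[`. -/
noncomputable def levelCoeff (a : ℤ → ℝ) (c : ℤ × ℤ →₀ X) (j : ℤ) (t : ℝ) : X :=
  c (j, cell a j t)

theorem stronglyMeasurable_levelCoeff (a : ℤ → ℝ) (c : ℤ × ℤ →₀ X) (j : ℤ) :
    StronglyMeasurable (levelCoeff a c j) :=
  (StronglyMeasurable.of_discrete (f := fun k : ℤ => c (j, k))).comp_measurable
    (measurable_cell a j)

theorem exists_norm_levelCoeff_le (a : ℤ → ℝ) (c : ℤ × ℤ →₀ X) :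
    ∃ C : ℝ, ∀ j t, ‖levelCoeff a c j t‖ ≤ C := by
  refine ⟨∑ q ∈ c.support, ‖c q‖, fun j t => ?_⟩
  by_cases h : (j, cell a j t) ∈ c.support
  · exact Finset.single_le_sum (f := fun q => ‖c q‖) (fun _ _ => norm_nonneg _) h
  · rw [levelCoeff, Finsupp.notMem_support_iff.1 h, norm_zero]
    exact Finset.sum_nonneg fun _ _ => norm_nonneg _

/-- `E` is a finite union of level-`j₀` intervals, the ancestors of those carrying coefficients.
Swaps at level `j₀` or finer stay within such ancestors. -/
theorem IsNested.exists_support_subset (ha : IsNested a) (c : ℤ × ℤ →₀ X) (j₀ : ℤ) :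
    ∃ E : Set ℝ, MeasurableSet E ∧ volume E ≠ ∞ ∧ ∀ j, j₀ ≤ j →
      halfSwap a j ⁻¹' E = E ∧ Function.support (levelCoeff a c j) ⊆ E := by
  have : ∀ j, ∃ f : ℤ → ℤ, j₀ ≤ j → ∀ t, cell a j₀ t = f (cell a j t) := fun j => by
    by_cases h : j₀ ≤ j
    · obtain ⟨f, hf⟩ := ha.exists_ancestor h
      exact ⟨f, fun _ => hf⟩
    · exact ⟨id, fun h' => absurd h' h⟩
  choose f hf using this
  refine ⟨cell a j₀ ⁻¹' (c.support.image fun q => f q.1 q.2 : Finset ℤ),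
    measurable_cell a j₀ (Set.to_countable _).measurableSet,
    (volume_cell_preimage_lt_top a j₀ _).ne, fun j hj => ⟨?_, fun t ht => ?_⟩⟩
  · ext t
    rw [Set.mem_preimage, Set.mem_preimage, ha.cell_halfSwap_of_le hj, Set.mem_preimage]
  · rw [Set.mem_preimage, hf j hj]
    exact Finset.mem_coe.2 (Finset.mem_image.2
      ⟨(j, cell a j t), Finsupp.mem_support_iff.2 ht, rfl⟩)

theorem memLp_of_bound_of_support {Ω : Type*} [MeasurableSpace Ω] {μ : Measure Ω} {p : ℝ≥0∞}
    {f : Ω → X} {E : Set Ω} (hE : MeasurableSet E) (hμE : μ E ≠ ∞) (hf : StronglyMeasurable f)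
    {C : ℝ} (hC : ∀ ω, ‖f ω‖ ≤ C) (hsupp : Function.support f ⊆ E) : MemLp f p μ := by
  have : IsFiniteMeasure (μ.restrict E) := ⟨by simpa using hμE.lt_top⟩
  rw [← Set.indicator_eq_self.2 hsupp, memLp_indicator_iff_restrict hE]
  exact MemLp.of_bound hf.aestronglyMeasurable C (Filter.Eventually.of_forall hC)

end Support

/-! ### Norm comparison of Haar sums over two lattices -/

section Estimate

variable {X : Type*} [NormedAddCommGroup X] [NormedSpace ℝ X]

/-- The `L^p` norm of the Rademacher sum `∑ ε_i G_i`, where `G_i` is constant on the intervals of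
the lattice `a` of level `j₀ + i`, with values given by `c`. -/
noncomputable def randomNorm (p : ℝ≥0∞) (a : ℤ → ℝ) (c : ℤ × ℤ →₀ X) (j₀ : ℤ) (n : ℕ) : ℝ≥0∞ :=
  eLpNorm (fun q : ℝ × (Fin n → Bool) =>
    ∑ i ∈ Finset.range n, rademacher q.2 i • levelCoeff a c (j₀ + i) q.1) p
    (volume.prod (signMeasure n))

theorem randomNorm_eq (p : ℝ≥0∞) (a : ℤ → ℝ) (c : ℤ × ℤ →₀ X) (j₀ : ℤ) (n : ℕ) :
    randomNorm p a c j₀ n = eLpNorm (fun q : ℝ × (Fin n → Bool) =>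
      ∑ i ∈ Finset.range n,
        rademacher q.2 i • halfSign a (j₀ + i) q.1 • levelCoeff a c (j₀ + i) q.1) p
      (volume.prod (signMeasure n)) :=
  (eLpNorm_rademacher_sum_smul p (g := fun i => levelCoeff a c (j₀ + i))
    (s := fun i => halfSign a (j₀ + i))
    (fun _ => stronglyMeasurable_levelCoeff a c _) (fun _ => halfSign_eq_or a _)
    (fun _ => measurable_halfSign a _)).symm

theorem stronglyMeasurable_haar_term (a : ℤ → ℝ) (c : ℤ × ℤ →₀ X) (j : ℤ) :
    StronglyMeasurable fun t => halfSign a j t • levelCoeff a c j t :=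
  ((measurable_halfSign a j).stronglyMeasurable).smul (stronglyMeasurable_levelCoeff a c j)

theorem sum_range_two_mul {M : Type*} [AddCommMonoid M] (f : ℕ → M) (n : ℕ) :
    ∑ m ∈ Finset.range (2 * n), f m = ∑ i ∈ Finset.range n, (f (2 * i) + f (2 * i + 1)) := by
  induction n with
  | zero => simp
  | succ n ih =>
    rw [Finset.sum_range_succ, ← ih, mul_add, mul_one, Finset.sum_range_succ,
      Finset.sum_range_succ, add_assoc]

/-- Multiplication of `w` by the sign `-1` in the coordinate `i`. -/
noncomputable def flipSign {n : ℕ} (i : ℕ) (w : Fin n → Bool) : Fin n → Bool :=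
  mulSigns (fun l => if l = i then -1 else 1) w

theorem rademacher_flipSign {n : ℕ} (i : ℕ) (w : Fin n → Bool) {l : ℕ} (hl : l < n) :
    rademacher (flipSign i w) l = rademacher w l * if l = i then -1 else 1 :=
  rademacher_mulSigns (s := fun l => if l = i then -1 else 1)
    (fun l => by split_ifs <;> simp) w hl

/-- The Haar sum with coefficients `c` with respect to the lattice `a`. -/
noncomputable def haarSum (a : ℤ → ℝ) (c : ℤ × ℤ →₀ X) (t : ℝ) : X :=
  c.sum fun q x => haar q.1 q.2 (t - a q.1) • x

/-- The window of levels is chosen from `c` alone, so the same one serves both lattices. -/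
theorem exists_haarSum_eq (c : ℤ × ℤ →₀ X) : ∃ (j₀ : ℤ) (n : ℕ), ∀ (a : ℤ → ℝ) (t : ℝ),
    haarSum a c t = ∑ i ∈ Finset.range n,
      halfSign a (j₀ + i) t • levelCoeff a c (j₀ + i) t := by
  obtain ⟨N, hN⟩ : ∃ N : ℕ, ∀ q ∈ c.support, q.1.natAbs < N := by
    refine ⟨(c.support.sup fun q => q.1.natAbs) + 1, fun q hq => Nat.lt_succ_of_le ?_⟩
    exact Finset.le_sup (f := fun q : ℤ × ℤ => q.1.natAbs) hq
  refine ⟨-N, 2 * N, fun a t => ?_⟩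
  have hterm : ∀ i : ℕ, halfSign a (-N + i) t • levelCoeff a c (-N + i) t =
      c.sum fun q x => if q.1 = -N + i then haar q.1 q.2 (t - a q.1) • x else 0 := fun i => by
    rw [Finsupp.sum, Finset.sum_eq_single ((-N + i : ℤ), cell a (-N + i) t)]
    · rw [if_pos rfl, haar_sub_eq, if_pos rfl, levelCoeff]
    · rintro ⟨j, k⟩ _ hne
      by_cases hj : j = -N + i
      · subst hj
        rw [if_pos rfl, haar_sub_eq, if_neg (fun h => hne (by rw [h])), zero_smul]
      · exact if_neg hj
    · intro h
      rw [Finsupp.notMem_support_iff.1 h, smul_zero, ite_self]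
  simp only [hterm, Finsupp.sum, haarSum]
  rw [Finset.sum_comm]
  refine Finset.sum_congr rfl fun q hq => ?_
  have := hN q hq
  rw [Finset.sum_eq_single (q.1 + N).toNat, if_pos (by omega)]
  · intro i _ hi
    exact if_neg (by omega)
  · intro h
    rw [Finset.mem_range] at h
    omega

variable [CompleteSpace X] {p β : ℝ≥0∞} {a b : ℤ → ℝ}

/-- The extra factors `e` allow signs on the right-hand side as well, so one estimate serves for
introducing random signs and for removing them. -/
theorem IsUMDBound.eLpNorm_haar_sum_smul_le (hβ : IsUMDBound X p β) (hp : 1 ≤ p) (hp' : p ≠ ∞)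
    (ha : IsNested a) (c : ℤ × ℤ →₀ X) (j₀ : ℤ) (n : ℕ) (e : ℕ → ℝ) {ε : ℕ → ℝ}
    (hε : ∀ i, ε i = 1 ∨ ε i = -1) :
    eLpNorm (fun t => ∑ i ∈ Finset.range n,
        ε i • e i • halfSign a (j₀ + i) t • levelCoeff a c (j₀ + i) t) p volume
      ≤ β * eLpNorm (fun t => ∑ i ∈ Finset.range n,
        e i • halfSign a (j₀ + i) t • levelCoeff a c (j₀ + i) t) p volume := by
  obtain ⟨E, hE, hμE, hE'⟩ := ha.exists_support_subset c j₀
  obtain ⟨C, hC⟩ := exists_norm_levelCoeff_le a c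
  have hmeas : ∀ i : ℕ, StronglyMeasurable fun t =>
      e i • halfSign a (j₀ + i) t • levelCoeff a c (j₀ + i) t := fun i =>
    (((measurable_halfSign a _).stronglyMeasurable).smul
      (stronglyMeasurable_levelCoeff a c _)).const_smul _
  have hsupp : ∀ i : ℕ, (Function.support fun t =>
      e i • halfSign a (j₀ + i) t • levelCoeff a c (j₀ + i) t) ⊆ E := fun i t ht => by
    refine (hE' (j₀ + i) (by omega)).2 fun h => ht ?_
    simp only [h, smul_zero]
  refine hβ.eLpNorm_sum_le_of_odd hp hp' hE hμE (τ := fun i => halfSwap a (j₀ + i))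
    (fun i _ => hmeas i) (fun i _ => ?_) (fun i _ => hsupp i)
    (fun i _ => measurePreserving_halfSwap a _) (fun i _ => (hE' _ (by omega)).1)
    (fun i _ t => ?_) (fun i _ l hl t => ?_) hε
  · refine memLp_of_bound_of_support hE hμE (hmeas i) (C := |e i| * C) (fun t => ?_) (hsupp i)
    rw [norm_smul, norm_smul, Real.norm_eq_abs, Real.norm_eq_abs]
    gcongr
    rcases halfSign_eq_or a (j₀ + i) t with h | h <;> simpa [h] using hC _ t
  · simp only [levelCoeff, halfSign_halfSwap, cell_halfSwap, neg_smul, smul_neg]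
  · have hl' : j₀ + (l : ℤ) < j₀ + i := by omega
    simp only [levelCoeff, ha.halfSign_halfSwap_of_lt hl', ha.cell_halfSwap_of_le hl'.le]

theorem IsUMDBound.eLpNorm_haar_sum_le_randomNorm (hβ : IsUMDBound X p β) (hβ' : β ≠ ∞)
    (hp : 1 ≤ p) (hp' : p ≠ ∞) (ha : IsNested a) (c : ℤ × ℤ →₀ X) (j₀ : ℤ) (n : ℕ) :
    eLpNorm (fun t => ∑ i ∈ Finset.range n,
      halfSign a (j₀ + i) t • levelCoeff a c (j₀ + i) t) p volume
      ≤ β * randomNorm p a c j₀ n := by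
  have hmeas : StronglyMeasurable fun t => ∑ i ∈ Finset.range n,
      halfSign a (j₀ + i) t • levelCoeff a c (j₀ + i) t :=
    Finset.stronglyMeasurable_fun_sum _ fun i _ => stronglyMeasurable_haar_term a c (j₀ + i)
  rw [← eLpNorm_comp_measurePreserving hmeas.aestronglyMeasurable
    (measurePreserving_fst (ν := signMeasure n)), randomNorm_eq]
  refine eLpNorm_prod_le_of_forall (zero_lt_one.trans_le hp).ne' hp' hβ'
    (hmeas.comp_measurable measurable_fst)
    (stronglyMeasurable_rademacher_sum fun i => stronglyMeasurable_haar_term a c (j₀ + i))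
    fun w => ?_
  -- Taking the transform signs equal to the signs already present makes them cancel on the left.
  have h := hβ.eLpNorm_haar_sum_smul_le hp hp' ha c j₀ n (rademacher w) (rademacher_eq_or w)
  refine le_of_eq_of_le ?_ h
  congr 1
  funext t
  refine Finset.sum_congr rfl fun i _ => ?_
  have hsq : rademacher w i * rademacher w i = 1 := by
    rcases rademacher_eq_or w i with h | h <;> simp [h]
  rw [smul_smul, hsq, one_smul]

theorem IsUMDBound.randomNorm_le_eLpNorm_haar_sum (hβ : IsUMDBound X p β) (hβ' : β ≠ ∞)
    (hp : 1 ≤ p) (hp' : p ≠ ∞) (ha : IsNested a) (c : ℤ × ℤ →₀ X) (j₀ : ℤ) (n : ℕ) :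
    randomNorm p a c j₀ n
      ≤ β * eLpNorm (fun t => ∑ i ∈ Finset.range n,
        halfSign a (j₀ + i) t • levelCoeff a c (j₀ + i) t) p volume := by
  have hmeas : StronglyMeasurable fun t => ∑ i ∈ Finset.range n,
      halfSign a (j₀ + i) t • levelCoeff a c (j₀ + i) t :=
    Finset.stronglyMeasurable_fun_sum _ fun i _ => stronglyMeasurable_haar_term a c (j₀ + i)
  rw [← eLpNorm_comp_measurePreserving hmeas.aestronglyMeasurable
    (measurePreserving_fst (ν := signMeasure n)), randomNorm_eq]
  refine eLpNorm_prod_le_of_forall (zero_lt_one.trans_le hp).ne' hp' hβ'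
    (stronglyMeasurable_rademacher_sum fun i => stronglyMeasurable_haar_term a c (j₀ + i))
    (hmeas.comp_measurable measurable_fst) fun w => ?_
  simpa using hβ.eLpNorm_haar_sum_smul_le hp hp' ha c j₀ n 1 (rademacher_eq_or w)

/-- The two halves of the intervals can be exchanged in Rademacher sums: this is a martingale
transform for the martingale whose differences alternate between `ε_i G_i` and `ε_i r_i G_i`. -/
theorem IsUMDBound.eLpNorm_sub_halves_le (hβ : IsUMDBound X p β) (hp : 1 ≤ p) (hp' : p ≠ ∞)
    (ha : IsNested a) (c : ℤ × ℤ →₀ X) (j₀ : ℤ) (n : ℕ) {η : ℕ → ℝ}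
    (hη : ∀ i, η i = 1 ∨ η i = -1) :
    eLpNorm (fun q : ℝ × (Fin n → Bool) => ∑ i ∈ Finset.range n, rademacher q.2 i •
        (1 - η i * halfSign a (j₀ + i) q.1) • levelCoeff a c (j₀ + i) q.1) p
        (volume.prod (signMeasure n))
      ≤ β * eLpNorm (fun q : ℝ × (Fin n → Bool) => ∑ i ∈ Finset.range n, rademacher q.2 i •
        (1 + η i * halfSign a (j₀ + i) q.1) • levelCoeff a c (j₀ + i) q.1) p
        (volume.prod (signMeasure n)) := by
  obtain ⟨E, hE, hμE, hE'⟩ := ha.exists_support_subset c j₀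
  obtain ⟨C, hC⟩ := exists_norm_levelCoeff_le a c
  -- Index `2 * i` carries `ε_i G_i`, and index `2 * i + 1` carries `ε_i η_i r_i G_i`, where `r_i`
  -- is the half sign of level `j₀ + i`.
  let u : ℕ → ℝ → ℝ := fun m t =>
    if m % 2 = 0 then 1 else η (m / 2) * halfSign a (j₀ + (m / 2 : ℕ)) t
  have hu : ∀ m t, u m t = 1 ∨ u m t = -1 := fun m t => by
    simp only [u]
    split_ifs
    · exact Or.inl rfl
    · rcases hη (m / 2) with h | h <;>
        rcases halfSign_eq_or a (j₀ + (m / 2 : ℕ)) t with h' | h' <;>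
        rw [h, h'] <;> norm_num
  have hum : ∀ m, Measurable (u m) := fun m => by
    by_cases h : m % 2 = 0
    · simp only [u, if_pos h]; exact measurable_const
    · simp only [u, if_neg h]; exact (measurable_halfSign a _).const_mul _
  let d : ℕ → ℝ × (Fin n → Bool) → X := fun m q =>
    rademacher q.2 (m / 2) • u m q.1 • levelCoeff a c (j₀ + (m / 2 : ℕ)) q.1
  -- Even differences are odd in the new sign `ε_i`. Odd-indexed ones are odd under the half swap,
  -- which fixes `G_i` and hence also the preceding difference of the same level.
  let τ : ℕ → ℝ × (Fin n → Bool) → ℝ × (Fin n → Bool) := fun m =>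
    if m % 2 = 0 then Prod.map id (flipSign (m / 2))
    else Prod.map (halfSwap a (j₀ + (m / 2 : ℕ))) id
  -- This transform turns `1 + η_i r_i` into `1 - η_i r_i`.
  let ε : ℕ → ℝ := fun m => if m % 2 = 0 then 1 else -1
  have hd : ∀ m, StronglyMeasurable (d m) := fun m =>
    ((measurable_rademacher _).comp measurable_snd).stronglyMeasurable.smul
      ((((hum m).comp measurable_fst).stronglyMeasurable).smul
        ((stronglyMeasurable_levelCoeff a c _).comp_measurable measurable_fst))
  have hsupp : ∀ m, Function.support (d m) ⊆ E ×ˢ Set.univ := fun m q hq => by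
    refine ⟨(hE' (j₀ + (m / 2 : ℕ)) (by omega)).2 fun h => hq ?_, trivial⟩
    simp only [d, h, smul_zero]
  have hμE' : (volume.prod (signMeasure n)) (E ×ˢ Set.univ) ≠ ∞ := by
    rw [Measure.prod_prod, measure_univ, mul_one]; exact hμE
  have key := hβ.eLpNorm_sum_le_of_odd hp hp' (hE.prod MeasurableSet.univ) hμE' (n := 2 * n)
    (d := d) (τ := τ) (fun m _ => hd m) (fun m _ => ?_) (fun m _ => hsupp m) (fun m _ => ?_)
    (fun m _ => ?_) (fun m hm q => ?_) (fun m hm l hl q => ?_)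
    (ε := ε) (fun m => by simp only [ε]; split_ifs <;> simp)
  · have hfst : ∀ i, ε (2 * i) = 1 := fun i => by simp [ε]
    have hsnd : ∀ i, ε (2 * i + 1) = -1 := fun i => by simp [ε]
    have hu0 : ∀ i t, u (2 * i) t = 1 := fun i t => by simp [u]
    have hu1 : ∀ i t, u (2 * i + 1) t = η i * halfSign a (j₀ + i) t := fun i t => by
      simp only [u, if_neg (show ¬ (2 * i + 1) % 2 = 0 by omega),
        show (2 * i + 1) / 2 = i by omega]
    have h0 : ∀ i : ℕ, 2 * i / 2 = i := fun i => by omega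
    have h1 : ∀ i : ℕ, (2 * i + 1) / 2 = i := fun i => by omega
    simp only [sum_range_two_mul, hfst, hsnd, d, hu0, hu1, h0, h1] at key
    simpa only [sub_smul, add_smul, smul_sub, smul_add, one_smul, neg_smul, ← sub_eq_add_neg]
      using key
  · refine memLp_of_bound_of_support (hE.prod MeasurableSet.univ) hμE' (hd m) (C := C)
      (fun q => ?_) (hsupp m)
    have h1 : ‖d m q‖ = ‖levelCoeff a c (j₀ + (m / 2 : ℕ)) q.1‖ := by
      simp only [d]
      rcases rademacher_eq_or q.2 (m / 2) with h | h <;> rcases hu m q.1 with h' | h' <;>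
        simp [h, h']
    exact h1.trans_le (hC _ _)
  · simp only [τ]
    split_ifs
    · exact (MeasurePreserving.id _).prod
        ⟨measurable_of_countable _, map_signMeasure_mulSigns fun l => if l = m / 2 then -1 else 1⟩
    · exact (measurePreserving_halfSwap a _).prod (MeasurePreserving.id _)
  · simp only [τ]
    split_ifs
    · ext q; simp
    · ext q
      have := congrArg (q.1 ∈ ·) (hE' (j₀ + (m / 2 : ℕ)) (by omega)).1
      simpa using this
  · by_cases h : m % 2 = 0
    · simp only [d, τ, if_pos h, Prod.map_fst, Prod.map_snd, id,
        rademacher_flipSign _ _ (show m / 2 < n by omega), if_true, mul_neg_one, neg_smul]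
    · simp only [d, τ, u, if_neg h, Prod.map_fst, Prod.map_snd, id, levelCoeff, cell_halfSwap,
        halfSign_halfSwap, mul_neg, neg_smul, smul_neg]
  · by_cases h : m % 2 = 0
    · simp only [d, τ, if_pos h, Prod.map_fst, Prod.map_snd, id,
        rademacher_flipSign _ _ (show l / 2 < n by omega),
        if_neg (show ¬ l / 2 = m / 2 by omega), mul_one]
    · have hle : j₀ + ((l / 2 : ℕ) : ℤ) ≤ j₀ + (m / 2 : ℕ) := by omega
      by_cases h' : l % 2 = 0
      · simp only [d, τ, u, if_neg h, if_pos h', Prod.map_fst, Prod.map_snd, id, levelCoeff,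
          ha.cell_halfSwap_of_le hle]
      · have hlt : j₀ + ((l / 2 : ℕ) : ℤ) < j₀ + (m / 2 : ℕ) := by omega
        simp only [d, τ, u, if_neg h, if_neg h', Prod.map_fst, Prod.map_snd, id, levelCoeff,
          ha.cell_halfSwap_of_le hle, ha.halfSign_halfSwap_of_lt hlt]

/-- With `s` equal to `1` on the matching halves and `-1` on the others, `2 = (1 + s) + (1 - s)`.
The second part is bounded by `β` times the first, and the first is the same for both lattices. Over
`a`, its terms `1` and `s` contribute equal norms because random signs absorb `s`, so the factor `2`
cancels. -/
theorem IsUMDBound.randomNorm_le_randomNorm (hβ : IsUMDBound X p β) (hp : 1 ≤ p) (hp' : p ≠ ∞)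
    (hb : IsNested b) (hab : ∀ j, |a j - b j| ≤ (2 : ℝ) ^ (-j) / 2) (c : ℤ × ℤ →₀ X)
    (j₀ : ℤ) (n : ℕ) :
    randomNorm p b c j₀ n ≤ (1 + β) * randomNorm p a c j₀ n := by
  let η : ℕ → ℝ := fun i => sideSign a b (j₀ + i)
  have hη : ∀ i, η i = 1 ∨ η i = -1 := fun i => sideSign_eq_or a b _
  let s : ℕ → ℝ → ℝ := fun i t => η i * halfSign b (j₀ + i) t
  have hs : ∀ i t, s i t = 1 ∨ s i t = -1 := fun i t => by
    rcases hη i with h | h <;> rcases halfSign_eq_or b (j₀ + i) t with h' | h' <;> simp [s, h, h']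
  have hsm : ∀ i, Measurable (s i) := fun i => (measurable_halfSign b _).const_mul _
  let R : (ℕ → ℝ → ℝ) → (ℤ → ℝ) → ℝ × (Fin n → Bool) → X := fun v a' q =>
    ∑ i ∈ Finset.range n, rademacher q.2 i • v i q.1 • levelCoeff a' c (j₀ + i) q.1
  let N : (ℝ × (Fin n → Bool) → X) → ℝ≥0∞ := fun f => eLpNorm f p (volume.prod (signMeasure n))
  have hR : ∀ (v : ℕ → ℝ → ℝ) (a' : ℤ → ℝ), (∀ i, Measurable (v i)) →
      AEStronglyMeasurable (R v a') (volume.prod (signMeasure n)) := fun v a' hv =>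
    (stronglyMeasurable_rademacher_sum fun i => (hv i).stronglyMeasurable.smul
      (stronglyMeasurable_levelCoeff a' c (j₀ + i))).aestronglyMeasurable
  have hone : ∀ a', N (R 1 a') = randomNorm p a' c j₀ n := fun a' => by
    simp only [N, R, randomNorm, Pi.one_apply, one_smul]
  have hsN : N (R s a) = randomNorm p a c j₀ n :=
    eLpNorm_rademacher_sum_smul p (g := fun i => levelCoeff a c (j₀ + i))
      (fun _ => stronglyMeasurable_levelCoeff a c _) hs hsm
  -- Where `s = 1` the two indices agree; where `s = -1` the factor `1 + s` vanishes.
  have hmatch : R (1 + s) b = R (1 + s) a := by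
    funext q
    refine Finset.sum_congr rfl fun i _ => ?_
    rcases hs i q.1 with h | h
    · rw [levelCoeff, levelCoeff, cell_eq_of_sideSign_mul (hab (j₀ + i)) h]
    · simp [h]
  have hsub : N (R (1 - s) b) ≤ β * N (R (1 + s) b) :=
    hβ.eLpNorm_sub_halves_le hp hp' hb c j₀ n hη
  have hadd : R (1 + s) a = R 1 a + R s a := by
    funext q
    simp only [R, Pi.add_apply, add_smul, smul_add, Finset.sum_add_distrib]
  have htwo : R (1 + s) b + R (1 - s) b = (2 : ℝ) • R 1 b := by
    funext q
    simp only [R, Pi.add_apply, Pi.smul_apply, Finset.smul_sum, ← Finset.sum_add_distrib]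
    refine Finset.sum_congr rfl fun i _ => ?_
    simp only [Pi.sub_apply, Pi.one_apply, ← smul_add, ← add_smul, one_smul]
    rw [add_add_sub_cancel, one_add_one_eq_two, smul_comm]
  have h2 : 2 * randomNorm p b c j₀ n ≤ 2 * ((1 + β) * randomNorm p a c j₀ n) := by
    calc 2 * randomNorm p b c j₀ n = N ((2 : ℝ) • R 1 b) := by
          rw [← hone]; simp only [N, eLpNorm_const_smul]
          rw [Real.enorm_eq_ofReal zero_le_two, ENNReal.ofReal_ofNat]
      _ ≤ N (R (1 + s) b) + N (R (1 - s) b) := by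
          rw [← htwo]
          exact eLpNorm_add_le (hR _ _ fun i => measurable_const.add (hsm i))
            (hR _ _ fun i => measurable_const.sub (hsm i)) hp
      _ ≤ N (R (1 + s) b) + β * N (R (1 + s) b) := by gcongr
      _ = (1 + β) * N (R 1 a + R s a) := by rw [hmatch, hadd, add_mul, one_mul]
      _ ≤ (1 + β) * (N (R 1 a) + N (R s a)) := by
          gcongr
          exact eLpNorm_add_le (hR _ _ fun i => measurable_const) (hR _ _ hsm) hp
      _ = 2 * ((1 + β) * randomNorm p a c j₀ n) := by rw [hone, hsN]; ring
  exact (ENNReal.mul_le_mul_iff_right two_ne_zero ENNReal.ofNat_ne_top).1 h2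

/-- Haar sums with the same coefficients with respect to two lattices whose offsets differ by at
most half an interval have comparable norms. -/
theorem IsUMDBound.eLpNorm_haarSum_le (hβ : IsUMDBound X p β) (hβ' : β ≠ ∞) (hp : 1 ≤ p)
    (hp' : p ≠ ∞) (ha : IsNested a) (hb : IsNested b)
    (hab : ∀ j, |a j - b j| ≤ (2 : ℝ) ^ (-j) / 2) (c : ℤ × ℤ →₀ X) :
    eLpNorm (haarSum b c) p volume ≤ β * ((1 + β) * (β * eLpNorm (haarSum a c) p volume)) := by
  obtain ⟨j₀, n, h⟩ := exists_haarSum_eq c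
  rw [funext (h a), funext (h b)]
  calc _ ≤ β * randomNorm p b c j₀ n :=
        hβ.eLpNorm_haar_sum_le_randomNorm hβ' hp hp' hb c j₀ n
    _ ≤ β * ((1 + β) * randomNorm p a c j₀ n) := by
        gcongr; exact hβ.randomNorm_le_randomNorm hp hp' hb hab c j₀ n
    _ ≤ _ := by
        gcongr; exact hβ.randomNorm_le_eLpNorm_haar_sum hβ' hp hp' ha c j₀ n

end Estimate

/-! ### Haar sums as a linear map into `L^p` -/

section HaarMap

variable {X : Type*} [NormedAddCommGroup X] [NormedSpace ℝ X]

theorem memLp_haar_sub (p : ℝ≥0∞) (s : ℝ) (j k : ℤ) (x : X) :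
    MemLp (fun t => haar j k (t - s) • x) p volume := by
  have h := memLp_haarUnit_comp p (s + (2 : ℝ) ^ (-j) * k) ((2 : ℝ) ^ (-j)) (by positivity) x
  simpa only [haar, sub_sub] using h

theorem memLp_haarSum (p : ℝ≥0∞) (a : ℤ → ℝ) (c : ℤ × ℤ →₀ X) :
    MemLp (haarSum a c) p volume :=
  memLp_finsetSum _ fun q _ => memLp_haar_sub p (a q.1) q.1 q.2 (c q)

theorem haarSum_add (a : ℤ → ℝ) (c c' : ℤ × ℤ →₀ X) :
    haarSum a (c + c') = haarSum a c + haarSum a c' := by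
  funext t
  exact Finsupp.sum_add_index' (fun _ => smul_zero _) fun _ _ _ => smul_add _ _ _

theorem haarSum_smul (a : ℤ → ℝ) (r : ℝ) (c : ℤ × ℤ →₀ X) :
    haarSum a (r • c) = r • haarSum a c := by
  funext t
  rw [haarSum, Finsupp.sum_smul_index' fun _ => smul_zero _, Pi.smul_apply, haarSum,
    Finsupp.smul_sum]
  simp only [smul_comm r]

theorem haarSum_single (a : ℤ → ℝ) (j k : ℤ) (x : X) :
    haarSum a (Finsupp.single (j, k) x) = fun t => haar j k (t - a j) • x := by
  funext t
  exact Finsupp.sum_single_index (smul_zero _)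

/-- The Haar sum as a linear map from coefficients to `L^p`. -/
noncomputable def haarMap (X : Type*) [NormedAddCommGroup X] [NormedSpace ℝ X] (p : ℝ≥0∞)
    (a : ℤ → ℝ) : (ℤ × ℤ →₀ X) →ₗ[ℝ] Lp X p (volume : Measure ℝ) where
  toFun c := (memLp_haarSum p a c).toLp _
  map_add' c c' := by
    rw [← MemLp.toLp_add]
    exact MemLp.toLp_congr _ _ (by rw [haarSum_add])
  map_smul' r c := by
    rw [RingHom.id_apply, ← MemLp.toLp_const_smul]
    exact MemLp.toLp_congr _ _ (by rw [haarSum_smul])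

theorem norm_haarMap (p : ℝ≥0∞) (a : ℤ → ℝ) (c : ℤ × ℤ →₀ X) :
    ‖haarMap X p a c‖ = (eLpNorm (haarSum a c) p volume).toReal :=
  Lp.norm_toLp _ (memLp_haarSum p a c)

end HaarMap

/-! ### Density of Haar sums for `1 < p < ∞` -/

section Density

variable {X : Type*} [NormedAddCommGroup X] [NormedSpace ℝ X] {p : ℝ≥0∞} {a : ℤ → ℝ}

theorem measurableSet_cell_preimage (a : ℤ → ℝ) (j k : ℤ) : MeasurableSet (cell a j ⁻¹' {k}) :=
  measurable_cell a j (measurableSet_singleton k)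

theorem volume_cell_preimage (a : ℤ → ℝ) (j k : ℤ) :
    volume (cell a j ⁻¹' {k}) = ENNReal.ofReal ((2 : ℝ) ^ (-j)) := by
  have hpos : (0 : ℝ) < 2 ^ j := by positivity
  have : cell a j ⁻¹' {k} = Set.Ico (k / (2 : ℝ) ^ j + a j) ((k + 1) / (2 : ℝ) ^ j + a j) := by
    ext t
    rw [Set.mem_preimage, Set.mem_singleton_iff, cell_eq_iff, Set.mem_Ico, ← le_sub_iff_add_le,
      ← sub_lt_iff_lt_add (a := t), div_le_iff₀ hpos, lt_div_iff₀ hpos]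
  rw [this, Real.volume_Ico, zpow_neg]
  congr 1
  field_simp
  ring

theorem volume_cell_preimage_ne_top (a : ℤ → ℝ) (j k : ℤ) :
    volume (cell a j ⁻¹' {k}) ≠ ∞ := by
  rw [volume_cell_preimage]; exact ENNReal.ofReal_ne_top

/-- The indicator function of the interval `a j + [2^{-j} k, 2^{-j} (k + 1)[` times `x`. -/
noncomputable def cellLp (X : Type*) [NormedAddCommGroup X] [NormedSpace ℝ X] (p : ℝ≥0∞)
    (a : ℤ → ℝ) (j k : ℤ) (x : X) : Lp X p (volume : Measure ℝ) :=
  indicatorConstLp p (measurableSet_cell_preimage a j k) (volume_cell_preimage_ne_top a j k) x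

/-- The indicator of a half of `I` is `(1_I ± h_I) / 2`, with the sign given by the half. -/
theorem IsNested.cellLp_sub_mem_range (ha : IsNested a) (j k : ℤ) (x : X) :
    ∃ k' : ℤ, cellLp X p a (j + 1) k x - (1 / 2 : ℝ) • cellLp X p a j k' x
      ∈ LinearMap.range (haarMap X p a) := by
  obtain ⟨m, hm⟩ := ha.exists_succ j
  let σ : ℝ := if (k + m) % 2 = 0 then 1 / 2 else -(1 / 2)
  refine ⟨(k + m) / 2, Finsupp.single (j, (k + m) / 2) (σ • x), ?_⟩
  rw [cellLp, cellLp, indicatorConstLp, indicatorConstLp, ← MemLp.toLp_const_smul,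
    ← MemLp.toLp_sub]
  refine MemLp.toLp_congr (memLp_haarSum p a _) _ (Filter.Eventually.of_forall fun t => ?_)
  obtain ⟨h1, h2⟩ := hm t
  rw [haarSum_single]
  have hind : ∀ i l, (cell a i ⁻¹' {l}).indicator (fun _ => x) t =
      if cell a i t = l then x else 0 := fun i l => by
    by_cases h : cell a i t = l <;> simp [h]
  simp only [haar_sub_eq, Pi.sub_apply, Pi.smul_apply, hind]
  by_cases hk : cell a (j + 1) t = k
  · rw [hk] at h1 h2
    rw [if_pos h1, if_pos hk, if_pos h1, h2]
    split_ifs with h0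
    · simp only [σ, if_pos h0]; module
    · simp only [σ, if_neg h0]; module
  · rw [if_neg hk]
    by_cases hk' : cell a j t = (k + m) / 2
    · rw [if_pos hk', if_pos hk', h2]
      split_ifs with h0
      · simp only [σ, if_neg (show ¬ (k + m) % 2 = 0 by omega)]; module
      · simp only [σ, if_pos (show (k + m) % 2 = 0 by omega)]; module
    · rw [if_neg hk', if_neg hk']; simp

theorem IsNested.cellLp_sub_pow_mem_range (ha : IsNested a) (j k : ℤ) (x : X) (n : ℕ) :
    ∃ k' : ℤ, cellLp X p a j k x - (1 / 2 : ℝ) ^ n • cellLp X p a (j - n) k' x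
      ∈ LinearMap.range (haarMap X p a) := by
  induction n with
  | zero => exact ⟨k, by simp⟩
  | succ n ih =>
    obtain ⟨k', hk'⟩ := ih
    obtain ⟨k'', hk''⟩ := ha.cellLp_sub_mem_range (p := p) (j - (n + 1 : ℕ)) k' x
    refine ⟨k'', ?_⟩
    rw [show j - (n + 1 : ℕ) + 1 = j - n by push_cast; ring] at hk''
    convert add_mem hk' (Submodule.smul_mem _ ((1 / 2 : ℝ) ^ n) hk'') using 1
    rw [smul_sub, smul_smul, pow_succ]
    abel

theorem norm_cellLp (hp : p ≠ 0) (hp' : p ≠ ∞) (j k : ℤ) (x : X) :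
    ‖cellLp X p a j k x‖ = ‖x‖ * ((2 : ℝ) ^ (-j)) ^ (1 / p.toReal) := by
  rw [cellLp, norm_indicatorConstLp hp hp', measureReal_def, volume_cell_preimage,
    ENNReal.toReal_ofReal (by positivity)]

/-- After `n` passages to the parent, the remainder has height `2^{-n}` on an interval `2^n` times
as long. Its norm is a constant times `(2^{1/p} / 2)^n`, which tends to `0` exactly because `p > 1`.
-/
theorem IsNested.cellLp_mem_closure [Fact (1 ≤ p)] (ha : IsNested a) (hp : 1 < p) (hp' : p ≠ ∞)
    (j k : ℤ) (x : X) :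
    cellLp X p a j k x ∈ (LinearMap.range (haarMap X p a)).topologicalClosure := by
  choose k' hk' using ha.cellLp_sub_pow_mem_range (p := p) j k x
  have hp0 : p ≠ 0 := (zero_lt_one.trans hp).ne'
  have h1p : 1 < p.toReal := by
    rw [← ENNReal.toReal_one]; exact (ENNReal.toReal_lt_toReal ENNReal.one_ne_top hp').2 hp
  have hr : (2 : ℝ) ^ (1 / p.toReal) / 2 < 1 := by
    rw [div_lt_one two_pos]
    calc (2 : ℝ) ^ (1 / p.toReal) < 2 ^ (1 : ℝ) :=
          Real.rpow_lt_rpow_of_exponent_lt one_lt_two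
            (by rw [div_lt_one (zero_lt_one.trans h1p)]; exact h1p)
      _ = 2 := Real.rpow_one 2
  have hlim : Filter.Tendsto (fun n : ℕ => (1 / 2 : ℝ) ^ n • cellLp X p a (j - n) (k' n) x)
      Filter.atTop (nhds 0) := by
    rw [tendsto_zero_iff_norm_tendsto_zero]
    have hn : ∀ n : ℕ, ‖(1 / 2 : ℝ) ^ n • cellLp X p a (j - n) (k' n) x‖ =
        ‖x‖ * ((2 : ℝ) ^ (-j)) ^ (1 / p.toReal) * ((2 : ℝ) ^ (1 / p.toReal) / 2) ^ n := fun n => by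
      have hpow : (2 : ℝ) ^ (-(j - n : ℤ)) = 2 ^ (-j) * 2 ^ n := by
        rw [neg_sub, sub_eq_neg_add, zpow_add₀ two_ne_zero, zpow_natCast]
      rw [norm_smul, norm_cellLp hp0 hp', hpow, Real.mul_rpow (by positivity) (by positivity),
        ← Real.rpow_natCast_mul zero_le_two, mul_comm (n : ℝ), Real.rpow_mul_natCast zero_le_two,
        norm_pow, Real.norm_of_nonneg (by norm_num), div_pow, div_pow, one_pow]
      ring
    simp only [hn]
    simpa using (tendsto_pow_atTop_nhds_zero_of_lt_one (by positivity) hr).const_mul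
      (‖x‖ * ((2 : ℝ) ^ (-j)) ^ (1 / p.toReal))
  refine mem_closure_of_tendsto (b := Filter.atTop) ?_ (Filter.Eventually.of_forall hk')
  simpa using tendsto_const_nhds.sub hlim

/-- The left endpoint of the interval of level `j` containing `t`. -/
noncomputable def leftEnd (a : ℤ → ℝ) (j : ℤ) (t : ℝ) : ℝ := cell a j t / (2 : ℝ) ^ j + a j

theorem dist_leftEnd_le (a : ℤ → ℝ) (j : ℤ) (t : ℝ) : dist t (leftEnd a j t) ≤ (2 : ℝ) ^ (-j) := by
  have hpos : (0 : ℝ) < 2 ^ j := by positivity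
  obtain ⟨h1, h2⟩ := (cell_eq_iff (a := a) j t _).1 rfl
  have h1' := (div_le_iff₀ hpos).2 h1
  have h2' := (lt_div_iff₀ hpos).2 h2
  rw [add_div, one_div, ← zpow_neg] at h2'
  rw [Real.dist_eq, leftEnd, abs_le]
  constructor <;> linarith [zpow_pos (two_pos (α := ℝ)) (-j)]

theorem exists_memLp_comp_leftEnd [Fact (1 ≤ p)] {V : Submodule ℝ (Lp X p (volume : Measure ℝ))}
    {j : ℤ} (hV : ∀ k x, cellLp X p a j k x ∈ V) {g : ℝ → X} {R : ℝ}
    (hg : Function.support g ⊆ Set.Icc (-R) R) :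
    ∃ h : MemLp (g ∘ leftEnd a j) p volume, h.toLp _ ∈ V := by
  have hsum : ∀ S : Finset ℤ, ∃ h : MemLp (fun t => ∑ k ∈ S,
      (cell a j ⁻¹' {k}).indicator (fun _ => g (k / (2 : ℝ) ^ j + a j)) t) p volume,
      h.toLp _ ∈ V := fun S => by
    induction S using Finset.induction_on with
    | empty =>
      simp only [Finset.sum_empty]
      refine ⟨MemLp.zero, ?_⟩
      change MemLp.toLp (0 : ℝ → X) _ ∈ V
      rw [MemLp.toLp_zero]
      exact V.zero_mem
    | insert k S hk ih =>
      obtain ⟨h, hmem⟩ := ih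
      have h1 := memLp_indicator_const (μ := volume) p (measurableSet_cell_preimage a j k)
        (g (k / (2 : ℝ) ^ j + a j)) (Or.inr (volume_cell_preimage_ne_top a j k))
      simp only [Finset.sum_insert hk]
      exact ⟨h1.add h, add_mem (hV k _) hmem⟩
  have hpos : (0 : ℝ) < 2 ^ j := by positivity
  obtain ⟨h, hmem⟩ := hsum (Finset.Icc ⌊(-R - a j) * 2 ^ j⌋ ⌈(R - a j) * 2 ^ j⌉)
  have heq : (fun t => ∑ k ∈ Finset.Icc ⌊(-R - a j) * 2 ^ j⌋ ⌈(R - a j) * 2 ^ j⌉,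
      (cell a j ⁻¹' {k}).indicator (fun _ => g (k / (2 : ℝ) ^ j + a j)) t) = g ∘ leftEnd a j := by
    funext t
    rw [Finset.sum_eq_single (cell a j t)]
    · simp [leftEnd]
    · intro k _ hk
      exact Set.indicator_of_notMem (fun h => hk h.symm) _
    · intro hk
      rw [Set.indicator_of_mem (show t ∈ cell a j ⁻¹' {cell a j t} from rfl)]
      by_contra h0
      obtain ⟨h1, h2⟩ := hg h0
      refine hk (Finset.mem_Icc.2 ⟨?_, ?_⟩)
      · rw [← Int.cast_le (R := ℝ)]
        refine (Int.floor_le _).trans ?_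
        rw [← le_div_iff₀ hpos]; linarith
      · rw [← Int.cast_le (R := ℝ)]
        refine le_trans ?_ (Int.le_ceil _)
        rw [← div_le_iff₀ hpos]; linarith
  rw [heq] at h
  exact ⟨h, by convert hmem using 2; exact heq.symm⟩

theorem IsNested.denseRange_haarMap [Fact (1 ≤ p)] (ha : IsNested a) (hp : 1 < p) (hp' : p ≠ ∞) :
    DenseRange (haarMap X p a) := by
  set V := (LinearMap.range (haarMap X p a)).topologicalClosure
  suffices h : ∀ f, f ∈ V from fun f => h f
  have hVc : closure (V : Set (Lp X p (volume : Measure ℝ))) = V :=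
    (Submodule.isClosed_topologicalClosure _).closure_eq
  have hcont : ∀ (g : ℝ → X) (hg : MemLp g p volume), HasCompactSupport g → Continuous g →
      hg.toLp g ∈ V := by
    intro g hg hgs hgc
    rw [← SetLike.mem_coe, ← hVc, EMetric.mem_closure_iff]
    intro ε hε
    obtain ⟨R, hR⟩ := hgs.isCompact.isBounded.subset_closedBall (0 : ℝ)
    rw [Real.closedBall_eq_Icc, zero_sub, zero_add] at hR
    have hsupp : Function.support g ⊆ Set.Icc (-R) R := (subset_tsupport g).trans hR
    -- The margin `1` holds the support of `g ∘ leftEnd a n`, since left endpoints at levels `n ≥ 0`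
    -- are within distance `1`.
    have hK : (volume (Set.Icc (-(R + 1)) (R + 1))) ^ (1 / p.toReal) ≠ ∞ :=
      ENNReal.rpow_ne_top_of_nonneg (by positivity) (by simp)
    -- A uniform error `η` on this bounded interval costs less than `ε` in `L^p`.
    obtain ⟨η, hη, hηε⟩ := ENNReal.exists_nnreal_pos_mul_lt hK hε.ne'
    obtain ⟨δ, hδ, hgδ⟩ := Metric.uniformContinuous_iff.1
      (hgs.uniformContinuous_of_continuous hgc) η (by exact_mod_cast hη)
    obtain ⟨n, hn⟩ := exists_pow_lt_of_lt_one hδ (one_half_lt_one (α := ℝ))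
    have hdist : ∀ t, dist t (leftEnd a n t) ≤ (1 / 2 : ℝ) ^ n := fun t => by
      simpa using dist_leftEnd_le a n t
    obtain ⟨h, hmem⟩ := exists_memLp_comp_leftEnd (j := (n : ℤ)) (V := V)
      (fun k x => ha.cellLp_mem_closure hp hp' n k x) hsupp
    refine ⟨_, hmem, ?_⟩
    rw [Lp.edist_toLp_toLp]
    refine (eLpNorm_sub_le_of_dist_bdd volume hp' measurableSet_Icc η.2 (fun t => ?_) ?_ ?_).trans_lt
      (by simpa using hηε)
    · exact (hgδ ((hdist t).trans_lt hn)).le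
    · exact hsupp.trans (Set.Icc_subset_Icc (by linarith) (by linarith))
    · intro t ht
      obtain ⟨h1, h2⟩ := hsupp (show leftEnd a n t ∈ Function.support g from ht)
      have h3 := (hdist t).trans (pow_le_one₀ (by norm_num) (by norm_num))
      rw [Real.dist_eq, abs_le] at h3
      constructor <;> linarith
  intro f
  rw [← SetLike.mem_coe, ← hVc, EMetric.mem_closure_iff]
  intro ε hε
  obtain ⟨g, hgs, hgε, hgc, hg⟩ := (Lp.memLp f).exists_hasCompactSupport_eLpNorm_sub_le hp'
    (ENNReal.half_pos hε.ne').ne'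
  by_cases hεt : ε = ∞
  · exact ⟨_, hcont g hg hgs hgc, by rw [hεt]; exact edist_lt_top _ _⟩
  refine ⟨_, hcont g hg hgs hgc, ?_⟩
  rw [← Lp.toLp_coeFn f (Lp.memLp f), Lp.edist_toLp_toLp]
  exact hgε.trans_lt (ENNReal.half_lt_self hε.ne' hεt)

end Density

/-! ### The one-third-shift lattice and extension to an isomorphism -/

theorem isNested_zero : IsNested 0 := fun j => ⟨0, by simp⟩

/-- The alternating sign and the third are what make this work: in units of `2^{-(j+1)}`,
consecutive offsets differ by `(-1)^j (2/3 + 1/3) = (-1)^j`, an integer. -/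
theorem isNested_shiftWidth : IsNested shiftWidth := by
  intro j
  have h : (shiftWidth j - shiftWidth (j + 1)) * (2 : ℝ) ^ (j + 1) = (-1 : ℝ) ^ j := by
    have h2 : (2 : ℝ) ^ j ≠ 0 := by positivity
    rw [shiftWidth, shiftWidth, zpow_neg, zpow_neg, zpow_add_one₀ two_ne_zero,
      zpow_add_one₀ (by norm_num)]
    field_simp
    norm_num
  rw [h]
  rcases Int.even_or_odd j with hj | hj
  · exact ⟨1, by simp [hj.neg_one_zpow]⟩
  · exact ⟨-1, by simp [hj.neg_one_zpow]⟩

theorem abs_shiftWidth_le (j : ℤ) : |shiftWidth j| ≤ (2 : ℝ) ^ (-j) / 2 := by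
  have h : |(-1 : ℝ) ^ j| = 1 := by rw [abs_zpow, abs_neg, abs_one, one_zpow]
  have hpos : (0 : ℝ) < 2 ^ (-j) := by positivity
  rw [shiftWidth, abs_div, abs_mul, h, abs_of_pos hpos, abs_of_pos (by norm_num : (0 : ℝ) < 3)]
  linarith

theorem actsAsOneThirdShift_iff {X : Type*} [NormedAddCommGroup X] [NormedSpace ℝ X] {p : ℝ≥0∞}
    [Fact (1 ≤ p)] (T : Lp X p (volume : Measure ℝ) →L[ℝ] Lp X p (volume : Measure ℝ)) :
    ActsAsOneThirdShift T ↔ ∀ c, T (haarMap X p 0 c) = haarMap X p shiftWidth c := by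
  have h0 : ∀ j k (x : X), haarMap X p 0 (Finsupp.single (j, k) x) =
      (memLp_haar p j k x).toLp _ := fun j k x =>
    MemLp.toLp_congr (memLp_haarSum p _ _) _ (by rw [haarSum_single]; simp only [Pi.zero_apply, sub_zero]; rfl)
  have h1 : ∀ j k (x : X), haarMap X p shiftWidth (Finsupp.single (j, k) x) =
      (memLp_haarShifted p j k x).toLp _ := fun j k x =>
    MemLp.toLp_congr (memLp_haarSum p _ _) _ (by rw [haarSum_single]; rfl)
  refine ⟨fun h c => ?_, fun h j k x => by rw [← h0, ← h1, h]⟩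
  have : T.toLinearMap ∘ₗ haarMap X p 0 = haarMap X p shiftWidth :=
    Finsupp.lhom_ext fun q x => by
      rw [LinearMap.comp_apply, h0, h1]
      exact h q.1 q.2 x
  exact LinearMap.congr_fun this c

theorem IsUMDBound.mono {X : Type*} [NormedAddCommGroup X] [NormedSpace ℝ X] [CompleteSpace X]
    {p β β' : ℝ≥0∞} (h : IsUMDBound X p β) (hle : β ≤ β') : IsUMDBound X p β' :=
  fun Ω mΩ μ hμ ℱ d hd ε hε n => (h Ω mΩ μ hμ ℱ d hd ε hε n).trans (by gcongr)

/-- Adding `1` makes it unnecessary to know that the infimum is attained. -/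
theorem IsUMD.isUMDBound {X : Type*} [NormedAddCommGroup X] [NormedSpace ℝ X] [CompleteSpace X]
    {p : ℝ≥0∞} (h : IsUMD X p) : IsUMDBound X p (umdConstant X p + 1) := by
  obtain ⟨β, hβ, hlt⟩ := sInf_lt_iff.1 (ENNReal.lt_add_right h.ne one_ne_zero)
  exact IsUMDBound.mono hβ hlt.le

/-- The bound for the one-third-shift operator and its inverse in terms of the UMD constant. -/
noncomputable def shiftBound (u : ℝ≥0∞) : ℝ :=
  ((u.toReal + 1) * (1 + (u.toReal + 1)) * (u.toReal + 1))

theorem shiftBound_pos (u : ℝ≥0∞) : 0 < shiftBound u := by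
  unfold shiftBound; positivity

theorem IsUMD.norm_haarMap_le {X : Type*} [NormedAddCommGroup X] [NormedSpace ℝ X]
    [CompleteSpace X] {p : ℝ≥0∞} (h : IsUMD X p) (hp : 1 ≤ p) (hp' : p ≠ ∞) {a b : ℤ → ℝ}
    (ha : IsNested a) (hb : IsNested b) (hab : ∀ j, |a j - b j| ≤ (2 : ℝ) ^ (-j) / 2)
    (c : ℤ × ℤ →₀ X) :
    ‖haarMap X p b c‖ ≤ shiftBound (umdConstant X p) * ‖haarMap X p a c‖ := by
  have hβ' : umdConstant X p + 1 ≠ ∞ := ENNReal.add_ne_top.2 ⟨h.ne, ENNReal.one_ne_top⟩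
  have hle := h.isUMDBound.eLpNorm_haarSum_le hβ' hp hp' ha hb hab c
  have hfin := (memLp_haarSum p a c).eLpNorm_ne_top
  have hle' := ENNReal.toReal_mono (ENNReal.mul_ne_top hβ' (ENNReal.mul_ne_top
    (ENNReal.add_ne_top.2 ⟨ENNReal.one_ne_top, hβ'⟩) (ENNReal.mul_ne_top hβ' hfin))) hle
  rw [norm_haarMap, norm_haarMap, shiftBound]
  rw [ENNReal.toReal_mul, ENNReal.toReal_mul, ENNReal.toReal_mul,
    ENNReal.toReal_add ENNReal.one_ne_top hβ', ENNReal.toReal_add h.ne ENNReal.one_ne_top,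
    ENNReal.toReal_one] at hle'
  linarith

/-- The two-sided estimate makes `e x ↦ f x` and its inverse well defined and bounded on dense
subspaces; both extend by completeness, and the inequalities pass to limits. -/
theorem exists_continuousLinearEquiv_of_norm_le {E F G : Type*} [AddCommGroup E] [Module ℝ E]
    [NormedAddCommGroup F] [NormedSpace ℝ F] [CompleteSpace F] [NormedAddCommGroup G]
    [NormedSpace ℝ G] [CompleteSpace G] {e : E →ₗ[ℝ] F} {f : E →ₗ[ℝ] G} (he : DenseRange e)
    (hf : DenseRange f) {C : ℝ} (hef : ∀ x, ‖f x‖ ≤ C * ‖e x‖) (hfe : ∀ x, ‖e x‖ ≤ C * ‖f x‖) :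
    ∃ S : F ≃L[ℝ] G, (∀ x, S (e x) = f x) ∧ (∀ u, ‖S u‖ ≤ C * ‖u‖) ∧ ∀ u, ‖u‖ ≤ C * ‖S u‖ := by
  obtain ⟨S, hS⟩ : ∃ S : F ≃L[ℝ] G, ∀ x, S (e x) = f x :=
    ⟨(LinearEquiv.refl ℝ E).extend e f he ⟨C, hef⟩ hf ⟨C, hfe⟩, fun x =>
      LinearEquiv.extend_eq (LinearEquiv.refl ℝ E) e f he ⟨C, hef⟩ hf ⟨C, hfe⟩ x⟩
  refine ⟨S, hS, fun u => ?_, fun u => ?_⟩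
  · refine he.induction_on u (isClosed_le (by fun_prop) (by fun_prop)) fun x => ?_
    rw [hS]
    exact hef x
  · refine he.induction_on u (isClosed_le (by fun_prop) (by fun_prop)) fun x => ?_
    rw [hS]
    exact hfe x

end OneThirdShift

theorem mainTheorem5 :
    ∃ C : ℝ≥0∞ → ℝ, (∀ β, 0 < C β) ∧
      ∀ (p : ℝ≥0∞) [Fact (1 ≤ p)], 1 < p → p < ∞ →
      ∀ (X : Type*) [NormedAddCommGroup X] [NormedSpace ℝ X] [CompleteSpace X],
        OneThirdShift.IsUMD X p →
        ∃ S : Lp X p (volume : Measure ℝ) ≃L[ℝ] Lp X p (volume : Measure ℝ),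
          OneThirdShift.ActsAsOneThirdShift
            (S : Lp X p (volume : Measure ℝ) →L[ℝ] Lp X p (volume : Measure ℝ)) ∧
          (∀ T : Lp X p (volume : Measure ℝ) →L[ℝ] Lp X p (volume : Measure ℝ),
            OneThirdShift.ActsAsOneThirdShift T →
              T = (S : Lp X p (volume : Measure ℝ) →L[ℝ] Lp X p (volume : Measure ℝ))) ∧
          ∀ u : Lp X p (volume : Measure ℝ),
            (C (OneThirdShift.umdConstant X p))⁻¹ * ‖u‖ ≤ ‖S u‖ ∧
            ‖S u‖ ≤ C (OneThirdShift.umdConstant X p) * ‖u‖ := by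
  open OneThirdShift in
  refine ⟨shiftBound, shiftBound_pos, fun p _ hp hp' X _ _ _ hX => ?_⟩
  have hd₀ := isNested_zero.denseRange_haarMap (X := X) hp hp'.ne
  have hd₁ := isNested_shiftWidth.denseRange_haarMap (X := X) hp hp'.ne
  have h₀₁ : ∀ c, ‖haarMap X p shiftWidth c‖ ≤ shiftBound (umdConstant X p) * ‖haarMap X p 0 c‖ :=
    hX.norm_haarMap_le hp.le hp'.ne isNested_zero isNested_shiftWidth fun j => by
      simpa using abs_shiftWidth_le j
  have h₁₀ : ∀ c, ‖haarMap X p 0 c‖ ≤ shiftBound (umdConstant X p) * ‖haarMap X p shiftWidth c‖ :=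
    hX.norm_haarMap_le hp.le hp'.ne isNested_shiftWidth isNested_zero fun j => by
      simpa using abs_shiftWidth_le j
  obtain ⟨S, hS, hle, hge⟩ := exists_continuousLinearEquiv_of_norm_le hd₀ hd₁ h₀₁ h₁₀
  refine ⟨S, (actsAsOneThirdShift_iff _).2 hS, fun T hT => ?_, fun u => ⟨?_, hle u⟩⟩
  -- Uniqueness: two continuous operators that agree on the dense set of Haar sums coincide.
  · refine ContinuousLinearMap.coeFn_injective (hd₀.equalizer T.continuous S.continuous ?_)
    funext c
    exact ((actsAsOneThirdShift_iff T).1 hT c).trans (hS c).symm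
  · rw [inv_mul_le_iff₀ (shiftBound_pos _)]
    exact hge u
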